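/- For $i,j,k,l\in\mathbb Z/3\mathbb Z$ let $c_{i,j,k,l}=\frac19$ if $i+j=kl$ in $\mathbb Z/3\mathbb Z$ and $c_{i,j,k,l}=0$ otherwise. A projection-valued measurement on a complex Hilbert space $\mathcal H$ is a family $(P_i)_{i\in\mathbb Z/3\mathbb Z}$ of bounded operators on $\mathcal H$ with $P_iP_j=\delta_{ij}P_i$, $P_i^*=P_i$ and $\sum_iP_i=I$. A commuting-operator strategy consists of a complex Hilbert space $\mathcal H$, projection-valued measurements $(A_i^k)_i$ and $(B_j^l)_j$ on $\mathcal H$ for $k,l\in\mathbb Z/3\mathbb Z$ such that $A_i^kB_j^l=B_j^lA_i^k$ for all $i,j,k,l$, and a unit vector $\psi\in\mathcal H$. Its value for the CHSH mod $3$ Bell function is $$\beta(A,B,\psi)=\Big\langle\psi,\ \sum_{i,j,k,l\in\mathbb Z/3\mathbb Z}c_{i,j,k,l}\,A_i^kB_j^l\,\psi\Big\rangle .$$ A tensor-product strategy consists of separable complex Hilbert spaces $\mathcal H_A,\mathcal H_B$, projection-valued measurements $(A_i^k)_i$ on $\mathcal H_A$ and $(B_j^l)_j$ on $\mathcal H_B$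 for $k,l\in\mathbb Z/3\mathbb Z$, and a unit vector $\psi\in\mathcal H_A\otimes\mathcal H_B$ (the Hilbert space tensor product); its value is $\beta(A\otimes I,I\otimes B,\psi)$. **Theorem.** The maximal quantum value of the CHSH mod $3$ Bell function is $$\frac13+\frac{2\cos(\pi/18)}{3\sqrt3}.$$ That is, every commuting-operator strategy and every tensor-product strategy has value at most this number, and this number is the value of some commuting-operator strategy and of some tensor-product strategy. -/

import Mathlib

open scoped TensorProduct ComplexInnerProductSpace

universe u v w

/-- A family `P` of bounded operators on a complex Hilbert space, indexed by the outcomes `ι`, is a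
projection-valued measurement. -/
structure IsPVM {ι H : Type*} [Fintype ι] [DecidableEq ι] [NormedAddCommGroup H]
    [InnerProductSpace ℂ H] [CompleteSpace H] (P : ι → H →L[ℂ] H) : Prop where
  mul_eq : ∀ i j, P i * P j = if i = j then P i else 0
  sum_eq_one : ∑ i, P i = 1
  adjoint_eq : ∀ i, ContinuousLinearMap.adjoint (P i) = P i

/-- The coefficient `c_{i,j,k,l}` of the CHSH mod `d` Bell function: `1 / d ^ 2` if
`i + j = k * l` modulo `d`, and `0` otherwise. Here `i, j` are the outcomes and `k, l` are the
measurement settings. -/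
noncomputable def chshCoeff (d : ℕ) (i j k l : ZMod d) : ℂ :=
  if i + j - k * l = 0 then 1 / (d : ℂ) ^ 2 else 0

/-- The operator `∑ c_{i,j,k,l} A_i^k B_j^l` on `H` (with `A k i` for `A_i^k`, `B l j` for
`B_j^l`). -/
noncomputable def chshOp (d : ℕ) [NeZero d] {H : Type*} [NormedAddCommGroup H]
    [InnerProductSpace ℂ H] (A B : ZMod d → ZMod d → H →L[ℂ] H) : H →L[ℂ] H :=
  ∑ i, ∑ j, ∑ k, ∑ l, chshCoeff d i j k l • (A k i * B l j)

/-- The value `ψ* p_d(A, B) ψ` of the CHSH mod `d` Bell function. (It is a real number when the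
`A k i` and `B l j` are commuting projections.) -/
noncomputable def chshValue (d : ℕ) [NeZero d] {H : Type*} [NormedAddCommGroup H]
    [InnerProductSpace ℂ H] (A B : ZMod d → ZMod d → H →L[ℂ] H) (ψ : H) : ℝ :=
  (⟪ψ, chshOp d A B ψ⟫).re

/-- The set of values of the CHSH mod `d` Bell function over all commuting-operator strategies:
`d` projection-valued measurements `A k` and `d` projection-valued measurements `B l` on one
complex Hilbert space such that each `A k i` commutes with each `B l j`, and a unit vector. -/
def chshCommutingValues (d : ℕ) [NeZero d] : Set ℝ :=
  {β | ∃ (H : Type u) (_ : NormedAddCommGroup H) (_ : InnerProductSpace ℂ H)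
    (_ : CompleteSpace H) (A B : ZMod d → ZMod d → H →L[ℂ] H) (ψ : H),
    (∀ k, IsPVM (A k)) ∧ (∀ l, IsPVM (B l)) ∧ (∀ k i l j, Commute (A k i) (B l j)) ∧
    ‖ψ‖ = 1 ∧ β = chshValue d A B ψ}

/-- The Hilbert space tensor product: the completion of the algebraic tensor product with respect
to the inner product with `⟪a ⊗ b, a' ⊗ b'⟫ = ⟪a, a'⟫ * ⟪b, b'⟫`. -/
abbrev HilbertTensor (E : Type v) (F : Type w) [NormedAddCommGroup E] [InnerProductSpace ℂ E]
    [NormedAddCommGroup F] [InnerProductSpace ℂ F] : Type (max v w) :=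
  UniformSpace.Completion (E ⊗[ℂ] F)

/-- The bounded operator `S ⊗ T` on the Hilbert space tensor product. -/
noncomputable def hilbertTensorOp {E : Type v} {F : Type w} [NormedAddCommGroup E]
    [InnerProductSpace ℂ E] [NormedAddCommGroup F] [InnerProductSpace ℂ F]
    (S : E →L[ℂ] E) (T : F →L[ℂ] F) : HilbertTensor E F →L[ℂ] HilbertTensor E F :=
  (TensorProduct.mapL S T).completion

/-- The set of values of the CHSH mod `d` Bell function over all tensor-product strategies:
`d` projection-valued measurements `A k` on a separable complex Hilbert space `E`, `d`
projection-valued measurements `B l` on a separable complex Hilbert space `F`, and a unit vector of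
the Hilbert space tensor product of `E` and `F`. -/
def chshTensorValues (d : ℕ) [NeZero d] : Set ℝ :=
  {β | ∃ (E : Type v) (_ : NormedAddCommGroup E) (_ : InnerProductSpace ℂ E)
    (_ : CompleteSpace E) (_ : TopologicalSpace.SeparableSpace E)
    (F : Type w) (_ : NormedAddCommGroup F) (_ : InnerProductSpace ℂ F)
    (_ : CompleteSpace F) (_ : TopologicalSpace.SeparableSpace F)
    (A : ZMod d → ZMod d → E →L[ℂ] E) (B : ZMod d → ZMod d → F →L[ℂ] F) (ψ : HilbertTensor E F),
    (∀ k, IsPVM (A k)) ∧ (∀ l, IsPVM (B l)) ∧ ‖ψ‖ = 1 ∧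
    β = chshValue d (fun k i => hilbertTensorOp (A k i) (1 : F →L[ℂ] F))
      (fun l j => hilbertTensorOp (1 : E →L[ℂ] E) (B l j)) ψ}

/-!
The upper bound is a sum-of-squares certificate. Put `ω = exp (2 π i / 3)` and encode the measurements
in the unitaries `A k = ∑ i, ω ^ i A_i^k` and `B l = ∑ j, ω ^ j B_j^l`, whose cubes are `1`. With
`T n = ∑ l, ω ^ (-n l) B l`, expanding the condition `i + j = k l` in characters of `ℤ/3ℤ` turns the
Bell operator into `(9 + X + X*) / 27` with `X = ∑ k, A k T k` (`chshValue_three`). So the claim is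
that `Re ⟨X⟩ ≤ 3 c / 2`, where `c = 2 √3 cos (π / 18)` is the root of `c ^ 3 = 9 c + 9` above `3`.

What is known of the operators is collected in `FourierRelations`: the `A k` are unitaries with
`A k ^ 2 = A k*`, they commute with the `T n`, and the `T n` satisfy the convolution relations
`∑ a, T a T (n - a) = 3 T (-n)*` and `∑ a, T a* T (a + n) = 9 δ_{n,0}`. They are invariant under a group
of twelve symmetries (shift and negation of the indices, and adjoints), so one may work with the
expectation of a word summed over its images, `moment`. The certificate consists of vectors
`x_i = (combination of words) ψ` with coefficients in `ℤ[c]`, of a positive matrix `R` over `ℤ[c]`,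
and of multipliers for instances of the convolution relations, such that
`∑ R_ij ⟨x_i, x_j⟩ + ∑ μ_r (relation r)` equals `c / 2 - A 0 T 0`, up to a positive factor, on moments.
Words are reduced to a representative of their class (`Word.canon`) and the identity is then
an identity of coefficients in `ℤ[c]`, which the kernel evaluates. Positivity of `R` at the real
number `c` is certified by a rounded Cholesky factor: the rest is diagonally dominant.

The bound is attained in `ℂ³ ⊗ ℂ³` with the maximally entangled state, where all the unitaries are
cyclic shifts with weights that are ninth roots of unity, and `T k` is `√3 exp (π i / 18)` times the
entrywise complex conjugate of `A k`. A tensor-product strategy is a commuting-operator strategy on the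
completed tensor product, so one upper bound and one strategy suffice for both halves of the theorem.
-/

/-! ### Integer polynomials in the extremal constant -/

/-- The element `a + b c + d c²` of the cubic order `ℤ[c]`, where `c ^ 3 = 9 * c + 9`. -/
structure CubicInt where
  a : ℤ
  b : ℤ
  d : ℤ
deriving DecidableEq

namespace CubicInt

/-- The sum in `ℤ[c]`. -/
def add (p q : CubicInt) : CubicInt := ⟨p.a + q.a, p.b + q.b, p.d + q.d⟩

/-- The product in `ℤ[c]`, reduced by `c ^ 3 = 9 * c + 9`. -/
def mul (p q : CubicInt) : CubicInt :=
  ⟨p.a * q.a + 9 * (p.b * q.d + p.d * q.b),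
    p.a * q.b + p.b * q.a + 9 * (p.b * q.d + p.d * q.b) + 9 * (p.d * q.d),
    p.a * q.d + p.b * q.b + p.d * q.a + 9 * (p.d * q.d)⟩

/-- The real number represented by an element of `ℤ[c]`. -/
def val (c : ℝ) (p : CubicInt) : ℝ := p.a + p.b * c + p.d * c ^ 2

theorem val_add (c : ℝ) (p q : CubicInt) : (p.add q).val c = p.val c + q.val c := by
  simp only [val, add]; push_cast; ring

theorem val_mul {c : ℝ} (hc : c ^ 3 = 9 * c + 9) (p q : CubicInt) :
    (p.mul q).val c = p.val c * q.val c := by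
  simp only [val, mul]; push_cast
  linear_combination (-(p.b * q.d + p.d * q.b : ℝ) - p.d * q.d * c) * hc

end CubicInt

/-! ### Words in the correlation operators -/

/-- A letter: an index modulo `3`, together with a flag saying whether the adjoint is taken. -/
abbrev Letter := Bool × Fin 3

/-- A word in two commuting alphabets: its letters on Alice's side and those on Bob's side. -/
abbrev Word := List Letter × List Letter

/-- A formal linear combination of words with coefficients in `ℤ[c]`. -/
abbrev Form := List (Word × CubicInt)

/-- The adjoint of a letter. -/
def Letter.flip (x : Letter) : Letter := (!x.1, x.2)

/-- Concatenation of words. -/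
def Word.mul (u v : Word) : Word := (u.1 ++ v.1, u.2 ++ v.2)

/-- The adjoint of a word. -/
def Word.adj (u : Word) : Word := ((u.1.map Letter.flip).reverse, (u.2.map Letter.flip).reverse)

/-- The action of a dihedral symmetry on letters: the flag `g.1` takes adjoints, the flag `g.2.1`
negates indices, and `g.2.2` is then added to them. -/
def Letter.act (g : Bool × Bool × Fin 3) (x : Letter) : Letter :=
  (xor g.1 x.1, (if g.2.1 then -x.2 else x.2) + g.2.2)

/-- The action of a dihedral symmetry on words. -/
def Word.act (g : Bool × Bool × Fin 3) (u : Word) : Word :=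
  (u.1.map (Letter.act g), u.2.map (Letter.act g))

/-- Left multiplication of a reduced list of Alice's letters by a letter, using that each of her
operators is a unitary with cube `1`. -/
def pushLetter (x : Letter) : List Letter → List Letter
  | [] => [x]
  | y :: l => if x.2 = y.2 then (if x.1 = y.1 then x.flip :: l else l) else x :: y :: l

/-- Reduction of Alice's letters. -/
def Word.reduce (u : Word) : Word := (u.1.foldr pushLetter [], u.2)

/-- A number that orders words, used to select one word in each orbit. -/
def Word.code (u : Word) : ℕ :=
  u.2.foldl (fun n x => 7 * n + (if x.1 then 3 else 0) + x.2.val + 1)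
    (7 * u.1.foldl (fun n x => 7 * n + (if x.1 then 3 else 0) + x.2.val + 1) 0)

/-- A representative of a word up to dihedral symmetry: the first letter is made the unitary of
index `0`, and the first letter of nonzero index is given the index `1`. -/
def Word.normalize (u : Word) : Word :=
  match u.1 ++ u.2 with
  | [] => u
  | x :: _ =>
    let v := u.act (x.1, false, -x.2)
    if (v.1 ++ v.2).find? (fun y => decide (y.2 ≠ 0)) |>.any (fun y => decide (y.2 = 2)) then
      v.act (false, true, 0)
    else v

/-- A representative of a word up to reduction, dihedral symmetry and adjoints. -/
def Word.canon (u : Word) : Word :=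
  let v := u.reduce
  let w := v.normalize
  let w' := v.adj.normalize
  if w'.code < w.code then w' else w

section Evaluation

variable {H : Type*} [NormedAddCommGroup H] [InnerProductSpace ℂ H] [CompleteSpace H]

/-- The operator named by a letter. -/
noncomputable def evalLetter (U : Fin 3 → H →L[ℂ] H) (x : Letter) : H →L[ℂ] H :=
  if x.1 then star (U x.2) else U x.2

/-- The product of the operators named by a list of letters. -/
noncomputable def evalList (U : Fin 3 → H →L[ℂ] H) (l : List Letter) : H →L[ℂ] H :=
  (l.map (evalLetter U)).prod

/-- The operator named by a word. -/
noncomputable def evalWord (A T : Fin 3 → H →L[ℂ] H) (u : Word) : H →L[ℂ] H :=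
  evalList A u.1 * evalList T u.2

/-- The relations between Alice's unitaries `A k = ∑ i, ω ^ i A_i^k` and the Fourier transforms
`T n = ∑ l, ω ^ (-n l) B_l` of Bob's unitaries `B_l = ∑ j, ω ^ j B_j^l`. -/
structure FourierRelations (A T : Fin 3 → H →L[ℂ] H) : Prop where
  adj_mul_self : ∀ k, star (A k) * A k = 1
  self_mul_adj : ∀ k, A k * star (A k) = 1
  mul_self : ∀ k, A k * A k = star (A k)
  comm : ∀ k n, Commute (A k) (T n)
  comm_star : ∀ k n, Commute (A k) (star (T n))
  conv : ∀ n, ∑ a, T a * T (n - a) = (3 : ℂ) • star (T (-n))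
  adj_conv : ∀ n, ∑ a, star (T a) * T (a + n) = if n = 0 then (9 : ℂ) • 1 else 0
  conv_adj : ∀ n, ∑ a, T a * star (T (a + n)) = if n = 0 then (9 : ℂ) • 1 else 0

/-- The action of a dihedral symmetry on a family of operators. -/
noncomputable def twist (g : Bool × Bool × Fin 3) (U : Fin 3 → H →L[ℂ] H) (k : Fin 3) :
    H →L[ℂ] H :=
  if g.1 then star (U ((if g.2.1 then -k else k) + g.2.2))
  else U ((if g.2.1 then -k else k) + g.2.2)

theorem FourierRelations.adjoint {A T : Fin 3 → H →L[ℂ] H} (h : FourierRelations A T) :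
    FourierRelations (fun k => star (A k)) (fun n => star (T n)) where
  adj_mul_self k := by simpa using h.self_mul_adj k
  self_mul_adj k := by simpa using h.adj_mul_self k
  mul_self k := by
    have := congrArg star (h.mul_self k)
    simpa using this
  comm k n := by simpa using (h.comm k n).star_star
  comm_star k n := by simpa using (h.comm_star k n).star_star
  conv n := by
    have := congrArg star (h.conv n)
    rw [← Equiv.sum_comp (Equiv.subLeft n)]
    simpa [star_sum, Equiv.subLeft] using this
  adj_conv n := by simpa using h.conv_adj n
  conv_adj n := by simpa using h.adj_conv n

theorem FourierRelations.neg {A T : Fin 3 → H →L[ℂ] H} (h : FourierRelations A T) :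
    FourierRelations (fun k => A (-k)) (fun n => T (-n)) where
  adj_mul_self k := h.adj_mul_self _
  self_mul_adj k := h.self_mul_adj _
  mul_self k := h.mul_self _
  comm k n := h.comm _ _
  comm_star k n := h.comm_star _ _
  conv n := by
    rw [← h.conv, ← Equiv.sum_comp (Equiv.neg (Fin 3))]
    simp [sub_eq_add_neg, add_comm]
  adj_conv n := by
    have := h.adj_conv (-n)
    rw [← Equiv.sum_comp (Equiv.neg (Fin 3))] at this
    simpa [add_comm] using this
  conv_adj n := by
    have := h.conv_adj (-n)
    rw [← Equiv.sum_comp (Equiv.neg (Fin 3))] at this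
    simpa [add_comm] using this

theorem FourierRelations.shift {A T : Fin 3 → H →L[ℂ] H} (h : FourierRelations A T) (s : Fin 3) :
    FourierRelations (fun k => A (k + s)) (fun n => T (n + s)) where
  adj_mul_self k := h.adj_mul_self _
  self_mul_adj k := h.self_mul_adj _
  mul_self k := h.mul_self _
  comm k n := h.comm _ _
  comm_star k n := h.comm_star _ _
  conv n := by
    have := h.conv (n + s + s)
    rw [← Equiv.sum_comp (Equiv.addRight s)] at this
    have e : -(n + s + s) = -n + s := by clear this; revert n s; decide
    rw [e] at this
    rw [← this]
    refine Finset.sum_congr rfl fun a _ => ?_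
    congr 2
    change n - a + s = n + s + s - (a + s)
    clear this e
    revert n s a; decide
  adj_conv n := by
    have := h.adj_conv n
    rw [← Equiv.sum_comp (Equiv.addRight s)] at this
    simpa [add_right_comm] using this
  conv_adj n := by
    have := h.conv_adj n
    rw [← Equiv.sum_comp (Equiv.addRight s)] at this
    simpa [add_right_comm] using this

/-- The relations are preserved by the dihedral symmetries. -/
theorem FourierRelations.twisted {A T : Fin 3 → H →L[ℂ] H} (h : FourierRelations A T)
    (g : Bool × Bool × Fin 3) : FourierRelations (twist g A) (twist g T) := by
  obtain ⟨b, r, s⟩ := g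
  have h1 := h.shift s
  have h2 := h1.neg
  cases b <;> cases r
  · exact h1
  · exact h2
  · exact h1.adjoint
  · exact h2.adjoint

theorem evalLetter_flip (U : Fin 3 → H →L[ℂ] H) (x : Letter) :
    evalLetter U x.flip = star (evalLetter U x) := by
  obtain ⟨b, k⟩ := x
  cases b <;> simp [evalLetter, Letter.flip]

theorem evalLetter_act (g : Bool × Bool × Fin 3) (U : Fin 3 → H →L[ℂ] H) (x : Letter) :
    evalLetter U (x.act g) = evalLetter (twist g U) x := by
  obtain ⟨b, k⟩ := x
  obtain ⟨b', r, s⟩ := g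
  cases b <;> cases b' <;> simp [evalLetter, Letter.act, twist]

theorem evalList_append (U : Fin 3 → H →L[ℂ] H) (l m : List Letter) :
    evalList U (l ++ m) = evalList U l * evalList U m := by
  simp [evalList]

theorem evalList_cons (U : Fin 3 → H →L[ℂ] H) (x : Letter) (l : List Letter) :
    evalList U (x :: l) = evalLetter U x * evalList U l := by
  simp [evalList]

theorem evalList_adj (U : Fin 3 → H →L[ℂ] H) (l : List Letter) :
    evalList U (l.map Letter.flip).reverse = star (evalList U l) := by
  induction l with
  | nil => simp [evalList]
  | cons x l ih =>
    rw [List.map_cons, List.reverse_cons, evalList_append, ih, evalList_cons _ x l, star_mul]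
    simp [evalList, evalLetter_flip]

theorem evalWord_act (g : Bool × Bool × Fin 3) (A T : Fin 3 → H →L[ℂ] H) (u : Word) :
    evalWord A T (u.act g) = evalWord (twist g A) (twist g T) u := by
  simp [evalWord, Word.act, evalList, Function.comp_def, evalLetter_act]

namespace FourierRelations

variable {A T : Fin 3 → H →L[ℂ] H} (h : FourierRelations A T)
include h

theorem commute_evalLetter (x y : Letter) : Commute (evalLetter A x) (evalLetter T y) := by
  obtain ⟨b, k⟩ := x
  obtain ⟨b', n⟩ := y
  cases b <;> cases b'
  · exact h.comm k n
  · exact h.comm_star k n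
  · simpa [evalLetter] using (h.comm_star k n).star_star
  · simpa [evalLetter] using (h.comm k n).star_star

theorem commute_evalList (l m : List Letter) : Commute (evalList A l) (evalList T m) := by
  refine Commute.list_prod_left _ _ fun a ha => Commute.list_prod_right _ _ fun b hb => ?_
  obtain ⟨x, -, rfl⟩ := List.mem_map.1 ha
  obtain ⟨y, -, rfl⟩ := List.mem_map.1 hb
  exact h.commute_evalLetter x y

theorem evalWord_mul (u v : Word) :
    evalWord A T (u.mul v) = evalWord A T u * evalWord A T v := by
  simp only [evalWord, Word.mul, evalList_append]
  rw [mul_assoc, ← mul_assoc (evalList A v.1), (h.commute_evalList v.1 u.2).eq]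
  simp only [mul_assoc]

theorem evalWord_adj (u : Word) : evalWord A T u.adj = star (evalWord A T u) := by
  simp only [evalWord, Word.adj, evalList_adj, star_mul]
  have := (h.commute_evalList u.1 u.2).star_star
  exact this.eq

theorem evalList_pushLetter (x : Letter) (l : List Letter) :
    evalList A (pushLetter x l) = evalLetter A x * evalList A l := by
  cases l with
  | nil => simp [pushLetter, evalList]
  | cons y l =>
    obtain ⟨b, k⟩ := x
    obtain ⟨b', k'⟩ := y
    simp only [pushLetter, evalList_cons]
    split_ifs with h1 h2
    · subst h1 h2
      rw [evalList_cons, evalLetter_flip, ← mul_assoc]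
      congr 1
      have h3 : star (A k) * star (A k) = A k := by simpa using congrArg star (h.mul_self k)
      cases b <;> simp [evalLetter, h.mul_self, h3]
    · subst h1
      rw [← mul_assoc]
      cases b <;> cases b' <;> simp_all [evalLetter, h.self_mul_adj, h.adj_mul_self]
    · simp [evalList_cons]

theorem evalWord_reduce (u : Word) : evalWord A T u.reduce = evalWord A T u := by
  have (l : List Letter) : evalList A (l.foldr pushLetter []) = evalList A l := by
    induction l with
    | nil => simp
    | cons x l ih => rw [List.foldr_cons, h.evalList_pushLetter, ih, evalList_cons]
  simp [evalWord, Word.reduce, this]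

end FourierRelations

/-- The real part of the expectation of a word in the state `ψ`, summed over the twelve dihedral
images of the word. -/
noncomputable def moment (A T : Fin 3 → H →L[ℂ] H) (ψ : H) (u : Word) : ℝ :=
  ∑ g : Bool × Bool × Fin 3, (⟪ψ, evalWord (twist g A) (twist g T) u ψ⟫).re

/-- The sum over the symmetry group makes moments invariant. -/
theorem moment_act (A T : Fin 3 → H →L[ℂ] H) (ψ : H) (u : Word) (k : Bool × Bool × Fin 3) :
    moment A T ψ (u.act k) = moment A T ψ u := by
  obtain ⟨b, r, s⟩ := k
  -- the composite of two symmetries, as a permutation of the first one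
  let e : (Bool × Bool × Fin 3) ≃ (Bool × Bool × Fin 3) :=
    Equiv.ofBijective
      (fun g => (xor g.1 b, xor g.2.1 r, (if g.2.1 then -s else s) + g.2.2))
      (by revert b r s; decide)
  unfold moment
  rw [← Equiv.sum_comp e fun g => (⟪ψ, evalWord (twist g A) (twist g T) u ψ⟫).re]
  refine Finset.sum_congr rfl fun g _ => ?_
  have key (U : Fin 3 → H →L[ℂ] H) : twist (b, r, s) (twist g U) = twist (e g) U := by
    obtain ⟨b', r', s'⟩ := g
    funext x
    have h1 : ((if r' = true then -((if r = true then -x else x) + s)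
        else (if r = true then -x else x) + s) + s') =
        (if (r' ^^ r) = true then -x else x) + ((if r' = true then -s else s) + s') := by
      clear * -
      revert r r' s s' x; decide
    have h2 : twist (e (b', r', s')) U x = if xor b' b then star (U ((if (r' ^^ r) = true then -x
        else x) + ((if r' = true then -s else s) + s'))) else U ((if (r' ^^ r) = true then -x
        else x) + ((if r' = true then -s else s) + s')) := rfl
    rw [h2, ← h1]
    cases b <;> cases b' <;> simp [twist]
  rw [evalWord_act, key, key]

theorem moment_normalize (A T : Fin 3 → H →L[ℂ] H) (ψ : H) (u : Word) :
    moment A T ψ u.normalize = moment A T ψ u := by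
  unfold Word.normalize
  split
  · rfl
  · dsimp only
    split_ifs <;> simp only [moment_act]

namespace FourierRelations

variable {A T : Fin 3 → H →L[ℂ] H} (h : FourierRelations A T)
include h

theorem moment_adj (ψ : H) (u : Word) : moment A T ψ u.adj = moment A T ψ u := by
  unfold moment
  refine Finset.sum_congr rfl fun g _ => ?_
  rw [(h.twisted g).evalWord_adj, ContinuousLinearMap.star_eq_adjoint,
    ContinuousLinearMap.adjoint_inner_right]
  exact inner_re_symm (𝕜 := ℂ) _ _

theorem moment_reduce (ψ : H) (u : Word) : moment A T ψ u.reduce = moment A T ψ u := by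
  unfold moment
  refine Finset.sum_congr rfl fun g _ => ?_
  rw [(h.twisted g).evalWord_reduce]

theorem moment_canon (ψ : H) (u : Word) : moment A T ψ u.canon = moment A T ψ u := by
  unfold Word.canon
  dsimp only
  split_ifs
  · rw [moment_normalize, h.moment_adj, h.moment_reduce]
  · rw [moment_normalize, h.moment_reduce]

end FourierRelations

end Evaluation

/-! ### Formal sums of moments -/

/-- The value of a formal combination of words under an assignment of reals to words. -/
noncomputable def Form.eval (c : ℝ) (m : Word → ℝ) (f : Form) : ℝ :=
  (f.map fun t => t.2.val c * m t.1).sum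

theorem Form.eval_append (c : ℝ) (m : Word → ℝ) (f g : Form) :
    Form.eval c m (f ++ g) = Form.eval c m f + Form.eval c m g := by
  simp [Form.eval]

theorem Form.eval_flatMap (c : ℝ) (m : Word → ℝ) {α : Type*} (l : List α) (f : α → Form) :
    Form.eval c m (l.flatMap f) = (l.map fun x => Form.eval c m (f x)).sum := by
  induction l with
  | nil => simp [Form.eval]
  | cons x l ih => rw [List.flatMap_cons, Form.eval_append, ih]; simp

/-- Adds a multiple of a word to a formal combination, merging equal words. -/
def Form.insert (u : Word) (p : CubicInt) : Form → Form
  | [] => [(u, p)]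
  | t :: f => if u.code = t.1.code ∧ u = t.1 then (t.1, t.2.add p) :: f else t :: Form.insert u p f

theorem Form.eval_insert (c : ℝ) (m : Word → ℝ) (u : Word) (p : CubicInt) (f : Form) :
    Form.eval c m (Form.insert u p f) = p.val c * m u + Form.eval c m f := by
  induction f with
  | nil => simp [Form.insert, Form.eval]
  | cons t f ih =>
    rw [Form.insert]
    split_ifs with h
    · obtain ⟨-, rfl⟩ := h
      simp [Form.eval, CubicInt.val_add]
      ring
    · simp only [Form.eval, List.map_cons, List.sum_cons] at ih ⊢
      rw [ih]; ring

/-- Collects the terms of a formal combination whose words have the same representative. -/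
def Form.collect (f : Form) : Form :=
  f.foldl (fun acc t => Form.insert t.1.canon t.2 acc) []

/-- Whether a formal combination vanishes after collecting terms. -/
def Form.isZero (f : Form) : Bool := f.collect.all fun t => decide (t.2 = ⟨0, 0, 0⟩)

/-- The soundness of `Form.isZero`: a combination whose terms cancel after collection is sent to zero
by every assignment that is constant on the classes of words. -/
theorem Form.eval_eq_zero {c : ℝ} {m : Word → ℝ} (hm : ∀ u : Word, m u.canon = m u) {f : Form}
    (hf : f.isZero = true) : Form.eval c m f = 0 := by
  have h1 (g acc : Form) : Form.eval c m (g.foldl (fun acc t => Form.insert t.1.canon t.2 acc) acc)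
      = Form.eval c m g + Form.eval c m acc := by
    induction g generalizing acc with
    | nil => simp [Form.eval]
    | cons t g ih =>
      rw [List.foldl_cons, ih, Form.eval_insert, hm]
      simp only [Form.eval, List.map_cons, List.sum_cons]; ring
  have h2 (g : Form) (hg : g.all (fun t => decide (t.2 = ⟨0, 0, 0⟩)) = true) :
      Form.eval c m g = 0 := by
    refine List.sum_eq_zero fun x hx => ?_
    obtain ⟨t, ht, rfl⟩ := List.mem_map.1 hx
    have := of_decide_eq_true (List.all_eq_true.1 hg t ht)
    simp [this, CubicInt.val]
  have h3 := h1 f []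
  rw [show Form.eval c m [] = 0 by simp [Form.eval], add_zero] at h3
  rw [← h3]
  exact h2 _ hf

/-! ### Convolution relations -/

/-- An instance of a convolution relation for Bob's operators, inside a word and with a coefficient:
the letters `(x, a)` and `(y, b)` between `pre` and `post` are summed over `a + b = n` if `x = y`
and over `b - a = n` otherwise. -/
structure ConvRelation where
  alice : List Letter
  pre : List Letter
  x : Bool
  y : Bool
  n : Fin 3
  post : List Letter
  coeff : CubicInt

/-- The formal combination of words that vanishes by a convolution relation. -/
def ConvRelation.form (r : ConvRelation) : Form :=
  ([0, 1, 2].map fun a : Fin 3 => ((r.alice, r.pre ++ (r.x, a) ::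
    (r.y, if r.x = r.y then r.n - a else a + r.n) :: r.post), r.coeff)) ++
  if r.x = r.y then [((r.alice, r.pre ++ (!r.x, -r.n) :: r.post), r.coeff.mul ⟨-3, 0, 0⟩)]
  else if r.n = 0 then [((r.alice, r.pre ++ r.post), r.coeff.mul ⟨-9, 0, 0⟩)] else []

section

variable {H : Type*} [NormedAddCommGroup H] [InnerProductSpace ℂ H] [CompleteSpace H]

/-- The value of a formal combination as an operator. -/
noncomputable def Form.op (c : ℝ) (A T : Fin 3 → H →L[ℂ] H) (f : Form) : H →L[ℂ] H :=
  (f.map fun t => (t.2.val c : ℂ) • evalWord A T t.1).sum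

theorem Form.eval_moment (c : ℝ) (A T : Fin 3 → H →L[ℂ] H) (ψ : H) (f : Form) :
    Form.eval c (moment A T ψ) f =
      ∑ g : Bool × Bool × Fin 3, (⟪ψ, Form.op c (twist g A) (twist g T) f ψ⟫).re := by
  induction f with
  | nil => simp [Form.eval, Form.op]
  | cons t f ih =>
    simp only [Form.eval, Form.op, List.map_cons, List.sum_cons] at ih ⊢
    rw [ih, moment, Finset.mul_sum, ← Finset.sum_add_distrib]
    refine Finset.sum_congr rfl fun g _ => ?_
    rw [add_apply, smul_apply, inner_add_right, inner_smul_right, Complex.add_re,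
      Complex.re_ofReal_mul]

theorem FourierRelations.op_convRelation {c : ℝ} (hc : c ^ 3 = 9 * c + 9)
    {A T : Fin 3 → H →L[ℂ] H} (h : FourierRelations A T) (r : ConvRelation) :
    Form.op c A T r.form = 0 := by
  obtain ⟨al, pre, x, y, n, post, p⟩ := r
  have hval (k : ℤ) : (p.mul ⟨k, 0, 0⟩).val c = p.val c * k := by
    rw [CubicInt.val_mul hc]; simp [CubicInt.val]
  have hconv := h.conv n
  have hconv' := h.adjoint.conv n
  have hadj := h.adj_conv n
  have hadj' := h.conv_adj n
  rw [Fin.sum_univ_three] at hconv hconv' hadj hadj'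
  have fact (a1 a2 b1 b2 c1 c2 S P Q : H →L[ℂ] H) (hS : a1 * a2 + b1 * b2 + c1 * c2 = S) (z : ℂ) :
      z • (P * (a1 * (a2 * Q))) + (z • (P * (b1 * (b2 * Q))) + z • (P * (c1 * (c2 * Q)))) =
        z • (P * (S * Q)) := by
    rw [← hS]; simp only [← smul_add, mul_add, mul_assoc, add_mul, add_assoc]
  have hpair (u v : Letter) : evalWord A T (al, pre ++ u :: v :: post) =
      evalList A al * evalList T pre * (evalLetter T u * (evalLetter T v * evalList T post)) := by
    simp only [evalWord, evalList_append, evalList_cons, mul_assoc]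
  have hsingle (u : Letter) : evalWord A T (al, pre ++ u :: post) =
      evalList A al * evalList T pre * (evalLetter T u * evalList T post) := by
    simp only [evalWord, evalList_append, evalList_cons, mul_assoc]
  have hnone : evalWord A T (al, pre ++ post) =
      evalList A al * evalList T pre * evalList T post := by
    simp only [evalWord, evalList_append, mul_assoc]
  cases x <;> cases y <;>
    simp only [ConvRelation.form, Form.op, List.map_cons, List.map_nil, List.map_append,
      List.sum_append, List.sum_cons, List.sum_nil, hpair, add_zero, if_true, hsingle, evalLetter,
      Bool.not_true, Bool.not_false, Bool.false_eq_true, Bool.true_eq_false, if_false]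
  · rw [fact _ _ _ _ _ _ _ _ _ hconv, hval]
    simp [smul_smul]
  · rw [fact _ _ _ _ _ _ _ _ _ hadj']
    split_ifs with hn
    · simp [hval, hnone, smul_smul, -Complex.coe_smul]
    · simp
  · rw [fact _ _ _ _ _ _ _ _ _ hadj]
    split_ifs with hn
    · simp [hval, hnone, smul_smul, -Complex.coe_smul]
    · simp
  · rw [fact _ _ _ _ _ _ _ _ _ hconv', hval]
    simp [smul_smul]

theorem FourierRelations.eval_convRelation {c : ℝ} (hc : c ^ 3 = 9 * c + 9)
    {A T : Fin 3 → H →L[ℂ] H} (h : FourierRelations A T) (ψ : H) (r : ConvRelation) :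
    Form.eval c (moment A T ψ) r.form = 0 := by
  rw [Form.eval_moment]
  exact Finset.sum_eq_zero fun g _ => by rw [(h.twisted g).op_convRelation hc]; simp

/-! ### Sums of squares -/

/-- The Gram form of two vectors given by formal combinations, times a coefficient. -/
def gramForm (r : CubicInt) (y z : Form) : Form :=
  y.flatMap fun s => z.map fun t => (s.1.adj.mul t.1, r.mul (s.2.mul t.2))

theorem FourierRelations.inner_op_gramForm {c : ℝ} (hc : c ^ 3 = 9 * c + 9)
    {A T : Fin 3 → H →L[ℂ] H} (h : FourierRelations A T) (ψ : H) (r : CubicInt) (y z : Form) :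
    ⟪ψ, Form.op c A T (gramForm r y z) ψ⟫ =
      r.val c * ⟪Form.op c A T y ψ, Form.op c A T z ψ⟫ := by
  have h1 : Form.op c A T (gramForm r y z) =
      (r.val c : ℂ) • (star (Form.op c A T y) * Form.op c A T z) := by
    have hop_append (f g : Form) : Form.op c A T (f ++ g) = Form.op c A T f + Form.op c A T g := by
      simp [Form.op]
    induction y with
    | nil => simp [gramForm, Form.op]
    | cons s y ih =>
      have h2 : Form.op c A T (z.map fun t => (s.1.adj.mul t.1, r.mul (s.2.mul t.2))) =
          ((r.val c : ℂ) * s.2.val c) • (star (evalWord A T s.1) * Form.op c A T z) := by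
        clear ih
        induction z with
        | nil => simp [Form.op]
        | cons t z ih =>
          simp only [Form.op, List.map_cons, List.sum_cons] at ih ⊢
          rw [ih, h.evalWord_mul, h.evalWord_adj, CubicInt.val_mul hc, CubicInt.val_mul hc, mul_add,
            smul_add, mul_smul_comm, smul_smul]
          push_cast
          rw [mul_assoc]
      rw [gramForm, List.flatMap_cons, hop_append, h2]
      rw [gramForm] at ih
      rw [ih]
      simp only [Form.op, List.map_cons, List.sum_cons, star_add, add_mul, smul_add]
      congr 1
      rw [star_smul, smul_mul_assoc, smul_smul]
      simp
  rw [h1, smul_apply, inner_smul_right, mul_apply_eq_comp,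
    ContinuousLinearMap.star_eq_adjoint, ContinuousLinearMap.adjoint_inner_right]

/-- The quadratic form with symmetric coefficient matrix `R` in the vectors `y 0, …, y (n - 1)`,
with the two equal terms of each off-diagonal pair merged. -/
def sosForm (n : ℕ) (R : ℕ → ℕ → CubicInt) (y : ℕ → Form) : Form :=
  (List.range n).flatMap fun i => (List.range (i + 1)).flatMap fun j =>
    gramForm (if j = i then R i j else (R i j).add (R i j)) (y i) (y j)

theorem List.sum_map_range_eq (f : ℕ → ℝ) (n : ℕ) :
    ((List.range n).map f).sum = ∑ i ∈ Finset.range n, f i := by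
  induction n with
  | zero => simp
  | succ n ih => simp [List.range_succ, Finset.sum_range_succ, ih]

theorem Finset.sum_range_sum_range_of_symm (f : ℕ → ℕ → ℝ) (hf : ∀ i j, f i j = f j i) (n : ℕ) :
    ∑ i ∈ Finset.range n, ∑ j ∈ Finset.range n, f i j =
      ∑ i ∈ Finset.range n, ∑ j ∈ Finset.range (i + 1),
        if j = i then f i j else f i j + f i j := by
  induction n with
  | zero => simp
  | succ n ih =>
    have h1 : ∑ j ∈ Finset.range n, (if j = n then f n j else f n j + f n j) =
        ∑ j ∈ Finset.range n, (f n j + f n j) :=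
      Finset.sum_congr rfl fun j hj => if_neg (Finset.mem_range.1 hj).ne
    rw [Finset.sum_range_succ (fun i => ∑ j ∈ Finset.range (i + 1),
      if j = i then f i j else f i j + f i j), ← ih]
    simp only [Finset.sum_range_succ _ n, Finset.sum_add_distrib, h1, if_true]
    rw [Finset.sum_congr rfl fun i _ => hf i n]
    ring

theorem FourierRelations.eval_sosForm_nonneg {c : ℝ} (hc : c ^ 3 = 9 * c + 9)
    {A T : Fin 3 → H →L[ℂ] H} (h : FourierRelations A T) (ψ : H) (n : ℕ)
    (R : ℕ → ℕ → CubicInt) (hRsymm : ∀ i j, R i j = R j i) (y : ℕ → Form)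
    (hR : ∀ x : ℕ → H, 0 ≤ ∑ i ∈ Finset.range n, ∑ j ∈ Finset.range n,
      (R i j).val c * (⟪x i, x j⟫).re) :
    0 ≤ Form.eval c (moment A T ψ) (sosForm n R y) := by
  let f (g : Bool × Bool × Fin 3) (i j : ℕ) : ℝ := (R i j).val c *
    (⟪Form.op c (twist g A) (twist g T) (y i) ψ, Form.op c (twist g A) (twist g T) (y j) ψ⟫).re
  have h1 (i j : ℕ) : Form.eval c (moment A T ψ)
      (gramForm (if j = i then R i j else (R i j).add (R i j)) (y i) (y j)) =
      ∑ g, if j = i then f g i j else f g i j + f g i j := by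
    simp only [Form.eval_moment, (h.twisted _).inner_op_gramForm hc, Complex.re_ofReal_mul]
    refine Finset.sum_congr rfl fun g _ => ?_
    split_ifs
    · rfl
    · rw [CubicInt.val_add, add_mul]
  have h2 : Form.eval c (moment A T ψ) (sosForm n R y) = ∑ g,
      ∑ i ∈ Finset.range n, ∑ j ∈ Finset.range n, f g i j := by
    simp only [sosForm, Form.eval_flatMap, List.sum_map_range_eq, h1]
    rw [Finset.sum_congr rfl fun i _ => Finset.sum_comm, Finset.sum_comm]
    refine Finset.sum_congr rfl fun g _ => ?_
    rw [Finset.sum_range_sum_range_of_symm]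
    intro i j
    simp only [f]
    rw [hRsymm i j, ← RCLike.re_to_complex, inner_re_symm, RCLike.re_to_complex]
  rw [h2]
  exact Finset.sum_nonneg fun g _ => hR _

end

/-! ### Positivity of the coefficient matrices -/

section

variable {H : Type*} [NormedAddCommGroup H] [InnerProductSpace ℂ H]

theorem sum_mul_inner_nonneg_of_diagonallyDominant (n : ℕ) (E : ℕ → ℕ → ℝ)
    (hE : ∀ i j, E i j = E j i)
    (hdom : ∀ i < n, ∑ j ∈ Finset.range n, (if j = i then 0 else |E i j|) ≤ E i i)
    (x : ℕ → H) :
    0 ≤ ∑ i ∈ Finset.range n, ∑ j ∈ Finset.range n, E i j * (⟪x i, x j⟫).re := by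
  -- each off-diagonal term is bounded by the mean of two squared norms
  have h1 : ∀ i ∈ Finset.range n, ∀ j ∈ Finset.range n,
      (if j = i then E i i * ‖x i‖ ^ 2 else -(|E i j| * ((‖x i‖ ^ 2 + ‖x j‖ ^ 2) / 2))) ≤
        E i j * (⟪x i, x j⟫).re := by
    intro i _ j _
    split_ifs with h
    · subst h
      rw [inner_self_eq_norm_sq_to_K (𝕜 := ℂ)]
      norm_cast
    · have h2 : |(⟪x i, x j⟫).re| ≤ (‖x i‖ ^ 2 + ‖x j‖ ^ 2) / 2 := by
        refine (Complex.abs_re_le_norm _).trans ((norm_inner_le_norm _ _).trans ?_)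
        nlinarith [sq_nonneg (‖x i‖ - ‖x j‖)]
      have h3 := neg_abs_le (E i j * (⟪x i, x j⟫).re)
      rw [abs_mul] at h3
      have h4 := mul_le_mul_of_nonneg_left h2 (abs_nonneg (E i j))
      linarith
  refine le_trans ?_ (Finset.sum_le_sum fun i hi => Finset.sum_le_sum fun j hj => h1 i hi j hj)
  have h2 : ∀ i ∈ Finset.range n, ∀ j ∈ Finset.range n,
      (if j = i then E i i * ‖x i‖ ^ 2 else -(|E i j| * ((‖x i‖ ^ 2 + ‖x j‖ ^ 2) / 2))) =
      (if j = i then E i i * ‖x i‖ ^ 2 else 0) - ((if j = i then 0 else |E i j|) * (‖x i‖ ^ 2 / 2)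
        + (if i = j then 0 else |E j i|) * (‖x j‖ ^ 2 / 2)) := by
    intro i _ j _
    rw [hE j i]
    by_cases h : j = i
    · simp [h]
    · simp [h, Ne.symm h]; ring
  rw [Finset.sum_congr rfl fun i hi => Finset.sum_congr rfl fun j hj => h2 i hi j hj]
  simp only [Finset.sum_sub_distrib, Finset.sum_add_distrib]
  rw [Finset.sum_comm (f := fun i j => (if i = j then 0 else |E j i|) * (‖x j‖ ^ 2 / 2))]
  simp only [← Finset.sum_mul, ← Finset.sum_add_distrib, ← Finset.sum_sub_distrib]
  refine Finset.sum_nonneg fun i hi => ?_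
  rw [Finset.sum_ite_eq' (Finset.range n) i, if_pos hi]
  have := mul_le_mul_of_nonneg_right (hdom i (Finset.mem_range.1 hi)) (sq_nonneg ‖x i‖)
  linarith

theorem sum_factor_mul_inner_nonneg (n : ℕ) (L : ℕ → ℕ → ℝ) (x : ℕ → H) :
    0 ≤ ∑ i ∈ Finset.range n, ∑ j ∈ Finset.range n,
      (∑ k ∈ Finset.range n, L i k * L j k) * (⟪x i, x j⟫).re := by
  have h1 (k : ℕ) : 0 ≤ ∑ i ∈ Finset.range n, ∑ j ∈ Finset.range n,
      L i k * L j k * (⟪x i, x j⟫).re := by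
    have h2 := inner_self_nonneg (𝕜 := ℂ) (x := ∑ i ∈ Finset.range n, (L i k : ℂ) • x i)
    simp only [sum_inner, inner_sum, inner_smul_left, inner_smul_right, Complex.conj_ofReal,
      RCLike.re_to_complex, Complex.re_sum, Complex.re_ofReal_mul] at h2
    refine h2.trans_eq (Finset.sum_congr rfl fun i _ => ?_)
    rw [Finset.mul_sum]
    refine Finset.sum_congr rfl fun j _ => ?_
    rw [← RCLike.re_to_complex, inner_re_symm, RCLike.re_to_complex]
    ring
  have h3 : ∑ i ∈ Finset.range n, ∑ j ∈ Finset.range n,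
      (∑ k ∈ Finset.range n, L i k * L j k) * (⟪x i, x j⟫).re =
      ∑ k ∈ Finset.range n, ∑ i ∈ Finset.range n, ∑ j ∈ Finset.range n,
      L i k * L j k * (⟪x i, x j⟫).re := by
    refine (Finset.sum_comm.trans (Finset.sum_congr rfl fun i _ =>
      Finset.sum_comm.trans (Finset.sum_congr rfl fun j _ => ?_))).symm
    exact (Finset.sum_mul _ _ _).symm
  rw [h3]
  exact Finset.sum_nonneg fun k _ => h1 k

/-- A numerical certificate of positivity of the matrix `R` over `ℤ[c]`, with `c ≈ c₁ / P` and
`c ^ 2 ≈ c₂ / P`: up to rounding errors, `P * (S * R - L * Lᵀ)` is diagonally dominant. -/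
def psdCheck (n : ℕ) (R : ℕ → ℕ → CubicInt) (L : ℕ → ℕ → ℤ) (S P c₁ c₂ : ℤ) : Bool :=
  (List.range n).all fun i => decide <|
    ((List.range n).map fun j =>
      let r := R i j
      let e := P * S * r.a + S * (r.b * c₁ + r.d * c₂) -
        P * ((List.range n).map fun k => L i k * L j k).sum
      let err := S * (|r.b| + |r.d|)
      if j = i then err - e else |e| + err).sum ≤ 0

/-- The soundness of `psdCheck`. -/
theorem sum_val_mul_inner_nonneg {c : ℝ} {n : ℕ} {R : ℕ → ℕ → CubicInt} {L : ℕ → ℕ → ℤ}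
    {S P c₁ c₂ : ℤ} (hS : 0 < S) (hP : 0 < P) (hc₁ : |P * c - c₁| ≤ 1) (hc₂ : |P * c ^ 2 - c₂| ≤ 1)
    (hR : ∀ i j, R i j = R j i) (h : psdCheck n R L S P c₁ c₂ = true) (x : ℕ → H) :
    0 ≤ ∑ i ∈ Finset.range n, ∑ j ∈ Finset.range n, (R i j).val c * (⟪x i, x j⟫).re := by
  let E (i j : ℕ) : ℝ := P * (S * (R i j).val c - ∑ k ∈ Finset.range n, (L i k : ℝ) * L j k)
  have hS' : (0 : ℝ) < S := by exact_mod_cast hS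
  have hP' : (0 : ℝ) < P := by exact_mod_cast hP
  have h1 := sum_mul_inner_nonneg_of_diagonallyDominant n E
    (fun i j => by simp only [E, hR i j, mul_comm]) ?_ x
  · have h2 := mul_nonneg hP'.le (sum_factor_mul_inner_nonneg n (fun i k => (L i k : ℝ)) x)
    have h3 : ∑ i ∈ Finset.range n, ∑ j ∈ Finset.range n, E i j * (⟪x i, x j⟫).re +
        P * ∑ i ∈ Finset.range n, ∑ j ∈ Finset.range n,
          (∑ k ∈ Finset.range n, (L i k : ℝ) * L j k) * (⟪x i, x j⟫).re =
        P * S * ∑ i ∈ Finset.range n, ∑ j ∈ Finset.range n, (R i j).val c * (⟪x i, x j⟫).re := by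
      rw [Finset.mul_sum, Finset.mul_sum, ← Finset.sum_add_distrib]
      refine Finset.sum_congr rfl fun i _ => ?_
      rw [Finset.mul_sum, Finset.mul_sum, ← Finset.sum_add_distrib]
      refine Finset.sum_congr rfl fun j _ => ?_
      simp only [E]
      ring
    exact nonneg_of_mul_nonneg_right (h3 ▸ add_nonneg h1 h2) (mul_pos hP' hS')
  · intro i hi
    have h4 := of_decide_eq_true (List.all_eq_true.1 h i (List.mem_range.2 hi))
    have h5 : ∑ j ∈ Finset.range n, (if j = i then -E i i else |E i j|) ≤ 0 := by
      refine le_trans ?_ (Int.cast_le (R := ℝ).2 h4 |>.trans_eq Int.cast_zero)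
      rw [Int.cast_list_sum, List.map_map, List.sum_map_range_eq]
      refine Finset.sum_le_sum fun j _ => ?_
      have key : |E i j - ((P * S * (R i j).a + S * ((R i j).b * c₁ + (R i j).d * c₂) -
          P * ((List.range n).map fun k => L i k * L j k).sum : ℤ) : ℝ)| ≤
          ((S * (|(R i j).b| + |(R i j).d|) : ℤ) : ℝ) := by
        push_cast
        rw [List.map_map, List.sum_map_range_eq]
        have : E i j - (P * S * (R i j).a + S * ((R i j).b * c₁ + (R i j).d * c₂) -
            P * ∑ k ∈ Finset.range n, ((fun m : ℤ => (m : ℝ)) ∘ fun k => L i k * L j k) k) =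
            S * ((R i j).b * (P * c - c₁) + (R i j).d * (P * c ^ 2 - c₂)) := by
          simp only [E, CubicInt.val, Function.comp_def, Int.cast_mul]; ring
        rw [this, abs_mul, abs_of_pos hS']
        refine mul_le_mul_of_nonneg_left ((abs_add_le _ _).trans ?_) hS'.le
        rw [abs_mul, abs_mul]
        exact add_le_add (mul_le_of_le_one_right (abs_nonneg _) hc₁)
          (mul_le_of_le_one_right (abs_nonneg _) hc₂)
      simp only [Function.comp_apply]
      split_ifs with hji
      · subst hji
        have := (abs_le.1 key).1
        push_cast at this ⊢
        linarith
      · have := abs_sub_abs_le_abs_sub (E i j) ((P * S * (R i j).a + S * ((R i j).b * c₁ +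
          (R i j).d * c₂) - P * ((List.range n).map fun k => L i k * L j k).sum : ℤ) : ℝ)
        have h6 := this.trans key
        push_cast at h6 ⊢
        linarith
    have h7 : ∑ j ∈ Finset.range n, (if j = i then -E i i else |E i j|) =
        ∑ j ∈ Finset.range n, ((if j = i then 0 else |E i j|) - if j = i then E i i else 0) := by
      refine Finset.sum_congr rfl fun j _ => ?_
      split_ifs <;> simp
    rw [h7, Finset.sum_sub_distrib, Finset.sum_ite_eq' (Finset.range n) i,
      if_pos (Finset.mem_range.2 hi)] at h5
    linarith

end

/-! ### The sum-of-squares certificate -/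

namespace Certificate

/-- The letter of index `0`. -/
abbrev x0 : Letter := (false, 0)
/-- The letter of index `1`. -/
abbrev x1 : Letter := (false, 1)
/-- The letter of index `2`. -/
abbrev x2 : Letter := (false, 2)
/-- The adjoint letter of index `0`. -/
abbrev y0 : Letter := (true, 0)
/-- The adjoint letter of index `1`. -/
abbrev y1 : Letter := (true, 1)
/-- The adjoint letter of index `2`. -/
abbrev y2 : Letter := (true, 2)

/-- Twice the part of a formal vector that is even (`s = 1`) or odd (`s = -1`) under negation of the
indices. -/
def parity (s : ℤ) (f : Form) : Form :=
  f ++ f.map fun t => (t.1.act (false, true, 0), ⟨s * t.2.a, s * t.2.b, s * t.2.d⟩)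

/-- Six times the formal vectors whose even parts enter the sum of squares. Each of them annihilates
the optimal state (a necessary condition for a tight certificate). -/
def evenVectors : List Form := [
  [(([], [y0]), ⟨6, 0, 0⟩), (([y0], [x0]), ⟨6, 0, 0⟩), (([x0], []), ⟨0, -6, 0⟩)],
  [(([x0, x1], [x1]), ⟨6, 0, 0⟩), (([y0], [x0]), ⟨-6, 0, 0⟩)],
  [(([x1, x0], [x1]), ⟨6, 0, 0⟩), (([y0], [x0]), ⟨3, 0, 0⟩)],
  [(([x1, x2], [x0]), ⟨6, 0, 0⟩), (([y1], [x2]), ⟨6, 0, 0⟩), (([y0], [x0]), ⟨-3, 0, 0⟩)],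
  [(([y0], [y1, y2]), ⟨6, 0, 0⟩), (([y1], [x2]), ⟨6, 0, 0⟩), (([y0], [x0]), ⟨-6, 0, 0⟩)],
  [(([y1], [y1, y0]), ⟨6, 0, 0⟩), (([y1], [x2]), ⟨6, 0, 0⟩), (([y0], [x0]), ⟨3, 0, 0⟩)],
  [(([y1], [y0, y1]), ⟨6, 0, 0⟩), (([y1], [x2]), ⟨-12, 0, 0⟩), (([y0], [x0]), ⟨-6, 0, 0⟩)],
  [(([y1], [x2]), ⟨6, 0, 0⟩), (([x0], []), ⟨9, 0, -3⟩), (([y0], [x0]), ⟨3, 3, 0⟩)],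
  [(([], [x1, x2]), ⟨6, 0, 0⟩), (([x0], []), ⟨-9, -9, 0⟩), (([y0], [x0]), ⟨9, 3, 0⟩)],
  [(([y1, y2], []), ⟨6, 0, 0⟩), (([x0], []), ⟨-6, -3, 0⟩), (([y0], [x0]), ⟨-3, 0, 1⟩)]]

/-- Six times the formal vectors whose odd parts enter the sum of squares; they too annihilate the
optimal state. -/
def oddVectors : List Form := [
  [(([x0, x1], [x1]), ⟨6, 0, 0⟩)],
  [(([y1], [y0, y1]), ⟨6, 0, 0⟩)],
  [(([x1, x0], [x1]), ⟨6, 0, 0⟩), (([x1, x2], [x0]), ⟨6, 0, 0⟩), (([y1], [x2]), ⟨6, 0, 0⟩)],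
  [(([y1], [y1, y0]), ⟨6, 0, 0⟩), (([x1, x2], [x0]), ⟨-6, 0, 0⟩), (([y1], [x2]), ⟨-12, 0, 0⟩)],
  [(([y0], [y1, y2]), ⟨6, 0, 0⟩), (([x1, x2], [x0]), ⟨12, 0, 0⟩), (([y1], [x2]), ⟨6, 0, 0⟩)],
  [(([], [x1, x2]), ⟨6, 0, 0⟩), (([y1, y2], []), ⟨-18, 0, 0⟩), (([y1], [x2]), ⟨0, 6, 0⟩)],
  [(([x1, x2], [x0]), ⟨6, 0, 0⟩), (([y1, y2], []), ⟨-18, 0, 6⟩), (([y1], [x2]), ⟨-6, -6, 0⟩)]]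

/-- The Gram coefficients of the even vectors (lower triangle), times `262440`. -/
def evenGram : List (List CubicInt) := [
  [⟨-73143, -10224, 11727⟩],
  [⟨77778, 28986, -14850⟩, ⟨4008, 2488, -848⟩],
  [⟨76338, 12420, -9858⟩, ⟨39132, 3492, -4338⟩, ⟨1692, 0, 0⟩],
  [⟨33282, 4590, -4248⟩, ⟨12840, 1164, -1446⟩, ⟨39456, 5568, -5052⟩, ⟨83016, 11136, -10104⟩],
  [⟨34290, 19932, -8172⟩, ⟨-27720, -5644, 4144⟩, ⟨14628, 2092, -1768⟩, ⟨11700, 2940, -1768⟩,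
  ⟨2772, 0, 0⟩],
  [⟨7830, -1584, 0⟩, ⟨2604, -848, 0⟩, ⟨-13380, -3240, 2160⟩, ⟨-14460, -3240, 2160⟩, ⟨396, 0, 0⟩,
  ⟨1908, 0, 0⟩],
  [⟨-31914, -15864, 7320⟩, ⟨-11412, -2940, 1768⟩, ⟨-13080, -2092, 1768⟩, ⟨-10188, -2940, 1768⟩,
  ⟨-36, 0, 0⟩, ⟨1440, 0, 0⟩, ⟨2088, 0, 0⟩],
  [⟨-124848, -49590, 23958⟩, ⟨62988, 15360, -9788⟩, ⟨-12204, 3984, 0⟩, ⟨-3528, 0, 0⟩,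
  ⟨-4416, 5584, -1596⟩, ⟨-59208, -13716, 8640⟩, ⟨-27960, -12640, 5916⟩, ⟨48276, 0, 0⟩],
  [⟨-3492, 0, 0⟩, ⟨-2556, 0, 120⟩, ⟨-2016, 0, -60⟩, ⟨4572, 0, -60⟩, ⟨0, 0, 0⟩, ⟨0, 0, 0⟩,
  ⟨0, 0, 0⟩, ⟨-15660, 0, 0⟩, ⟨10692, 0, 0⟩],
  [⟨-170640, -31428, 24084⟩, ⟨8856, 0, -756⟩, ⟨-8856, 0, 756⟩, ⟨0, 0, 0⟩, ⟨0, 0, 0⟩,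
  ⟨-2268, 0, 756⟩, ⟨-1728, 0, 576⟩, ⟨-94068, -15984, 10584⟩, ⟨6192, 0, 0⟩,
  ⟨-378000, -28296, 43416⟩]]

/-- The Gram coefficients of the odd vectors (lower triangle), times `262440`. -/
def oddGram : List (List CubicInt) := [
  [⟨5148, 0, 0⟩],
  [⟨432, 0, 0⟩, ⟨1800, 0, 0⟩],
  [⟨14136, 1164, -1446⟩, ⟨504, 0, 0⟩, ⟨1008, 0, 0⟩],
  [⟨864, 0, 0⟩, ⟨1728, 0, 0⟩, ⟨-13668, -3240, 2160⟩, ⟨3276, 0, 0⟩],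
  [⟨-180, 0, 0⟩, ⟨540, 0, 0⟩, ⟨180, 0, 0⟩, ⟨684, 0, 0⟩, ⟨324, 0, 0⟩],
  [⟨-2196, 0, 0⟩, ⟨0, 0, 0⟩, ⟨-2376, 0, 60⟩, ⟨0, 0, 0⟩, ⟨0, 0, 0⟩, ⟨5364, 0, 0⟩],
  [⟨-756, 0, 0⟩, ⟨576, 0, 0⟩, ⟨-576, 0, 0⟩, ⟨756, 0, 0⟩, ⟨0, 0, 0⟩, ⟨2196, 0, 0⟩, ⟨1512, 0, 0⟩]]

/-- A rounded Cholesky factor of `10 ^ 6 * (evenGram - 2)`. -/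
def evenFactor : List (List ℤ) := [
  [168691],
  [22742, 45906],
  [23591, 480, 33664],
  [-2953, 1075, -8190, 57752],
  [42566, 6233, 5388, 22798, 19249],
  [14383, -13419, 11062, -3935, -5323, 36782],
  [-4993, -16379, 14411, 8301, 610, 31769, 22507],
  [-90082, 76735, 103244, -52482, 2884, -121094, 60894, 49769],
  [-20701, -15001, -65909, 56948, 1635, 28773, -34972, -19511, 3881],
  [14450, -5905, -11752, -818, -25783, 169458, -10693, -25071, -5711, 14507]]

/-- A rounded Cholesky factor of `10 ^ 6 * (oddGram - 1 / 5)`. -/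
def oddFactor : List (List ℤ) := [
  [71748],
  [6021, 41995],
  [17815, 9447, 24519],
  [12042, 39422, -6922, 39100],
  [-2509, 13218, 4071, 5660, 9704],
  [-30607, 4388, -47878, -3474, 8220, 45120],
  [-10537, 15227, -21703, 3386, -16335, 20249, 3095]]

/-- The convolution relations, with multipliers, that reduce the sum of squares to the moments of the
identity and of `A 0 * T 0`. -/
def relations : List ConvRelation := [
  ⟨[x0, y1], [], false, false, 1, [y0, y2], ⟨-196992, 0, 0⟩⟩,
  ⟨[x0, y1], [x2], false, true, 1, [y2], ⟨98496, 0, 0⟩⟩,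
  ⟨[x0, y1], [], false, false, 2, [y2, y1], ⟨41472, 0, 0⟩⟩,
  ⟨[x0, y1], [x0], false, true, 1, [y0], ⟨-41472, 0, 0⟩⟩,
  ⟨[x0, y1], [x1, x0], true, true, 2, [], ⟨41472, 0, 0⟩⟩,
  ⟨[x0, y1], [x0, x1], true, true, 2, [], ⟨124416, 0, 0⟩⟩,
  ⟨[x0, y1], [x0], false, true, 0, [y1], ⟨-62208, 0, 0⟩⟩,
  ⟨[x0, x1, y2, y0], [], false, true, 1, [], ⟨-49248, 0, 0⟩⟩,
  ⟨[x0, x1, y0, y2], [], false, true, 1, [], ⟨-3599424, -335232, 416448⟩⟩,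
  ⟨[x0, x1, y0, y1], [], false, true, 0, [], ⟨-3835296, -335232, 416448⟩⟩,
  ⟨[x0, x1, x2], [], false, false, 0, [x0], ⟨-1705536, -423360, 254592⟩⟩,
  ⟨[x0, x1, x2], [x0], false, false, 0, [], ⟨1705536, 423360, -254592⟩⟩,
  ⟨[x0, x1, x0], [], false, false, 2, [x2], ⟨-51840, 0, 0⟩⟩,
  ⟨[x0, x1, x0], [], false, false, 0, [x1], ⟨-2080512, -301248, 254592⟩⟩,
  ⟨[x0, x1, x0], [x0], false, false, 1, [], ⟨1581120, 423360, -254592⟩⟩,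
  ⟨[x0, y1], [], false, false, 1, [x1], ⟨3188160, 1530432, -713664⟩⟩,
  ⟨[x0, y1], [], false, false, 0, [x2], ⟨4017600, 812736, -596736⟩⟩,
  ⟨[x0, y1], [], false, false, 2, [x0], ⟨9552384, 2973312, -1703232⟩⟩,
  ⟨[x0, y1], [x1], false, false, 1, [], ⟨-5657472, -2040192, 1081152⟩⟩,
  ⟨[x0, y1], [x2], false, false, 0, [], ⟨-1783296, -1107072, 459072⟩⟩,
  ⟨[x0, x1], [x1], true, true, 0, [], ⟨-51840, 0, 17280⟩⟩,
  ⟨[x0, x1], [], false, true, 2, [y0], ⟨51840, 0, -17280⟩⟩,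
  ⟨[x0, x1], [x2], true, true, 1, [], ⟨-684288, 0, 17280⟩⟩,
  ⟨[x0, x1], [], false, true, 0, [y2], ⟨684288, 0, -17280⟩⟩,
  ⟨[x0, x1, x2], [], false, true, 0, [], ⟨-3602880, -1060992, 558144⟩⟩,
  ⟨[x0, x1, x0], [], false, true, 2, [], ⟨-7715520, -981504, 974592⟩⟩,
  ⟨[], [], false, false, 1, [y0, y1], ⟨-2032128, 0, 0⟩⟩,
  ⟨[], [x0], false, true, 2, [y1], ⟨1016064, 0, 0⟩⟩,
  ⟨[x0, y1], [], true, false, 2, [], ⟨22985856, 5716224, -3683232⟩⟩,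
  ⟨[x0, y1], [], false, true, 1, [], ⟨-31315680, -8553600, 5151168⟩⟩,
  ⟨[x0], [], false, false, 0, [y0], ⟨-5064768, -2512512, 1045440⟩⟩,
  ⟨[x0], [x0], false, true, 0, [], ⟨5064768, 2512512, -1045440⟩⟩,
  ⟨[x0, x1], [], false, false, 1, [], ⟨-11638080, -1321920, 1275264⟩⟩,
  ⟨[x0], [], true, true, 0, [], ⟨-930528, -2753568, 990144⟩⟩,
  ⟨[], [], false, true, 0, [], ⟨810432, -286848, -413856⟩⟩]

/-- The entry at `(i, j)` of a symmetric matrix given by its lower triangle. -/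
def symmEntry (M : List (List CubicInt)) (i j : ℕ) : CubicInt :=
  (M.getD (max i j) []).getD (min i j) ⟨0, 0, 0⟩

/-- The entry at `(i, j)` of a lower triangular matrix given by its lower triangle. -/
def lowerEntry (M : List (List ℤ)) (i j : ℕ) : ℤ := (M.getD i []).getD j 0

/-- The sum of squares of the even vectors. -/
def evenForm : Form :=
  sosForm 10 (symmEntry evenGram) fun i => parity 1 (evenVectors.getD i [])

/-- The sum of squares of the odd vectors. -/
def oddForm : Form :=
  sosForm 7 (symmEntry oddGram) fun i => parity (-1) (oddVectors.getD i [])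

/-- The sum of squares plus the relations, minus `144 * 262440` times `c / 2 - A 0 * T 0`. The factor
`144` comes from the scaling of the vectors by `6` and from `parity`, which doubles the projection
onto one parity. -/
def sosIdentity : Form :=
  evenForm ++ (oddForm ++ (relations.flatMap ConvRelation.form ++
    [(([], []), ⟨0, -18895680, 0⟩), (([x0], [x0]), ⟨37791360, 0, 0⟩)]))

set_option maxRecDepth 100000 in
theorem sosIdentity_isZero : sosIdentity.isZero = true := by decide +kernel

theorem evenGram_psd : psdCheck 10 (symmEntry evenGram) (lowerEntry evenFactor)
    1000000 10000000000 34114741278 116381557247 = true := by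
  decide +kernel

theorem oddGram_psd : psdCheck 7 (symmEntry oddGram) (lowerEntry oddFactor)
    1000000 10000000000 34114741278 116381557247 = true := by
  decide +kernel

end Certificate

/-! ### The operator bound -/

section

variable {H : Type*} [NormedAddCommGroup H] [InnerProductSpace ℂ H] [CompleteSpace H]

/-- A decimal enclosure of the root of `c ^ 3 = 9 * c + 9` above `3`. -/
theorem cubicRoot_bounds {c : ℝ} (hc : c ^ 3 = 9 * c + 9) (h3 : 3 ≤ c) :
    |(10000000000 : ℤ) * c - (34114741278 : ℤ)| ≤ 1 ∧
      |(10000000000 : ℤ) * c ^ 2 - (116381557247 : ℤ)| ≤ 1 := by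
  have h1 : (3.411474127809 : ℝ) < c := by
    by_contra! h
    nlinarith [mul_nonneg (sub_nonneg.2 h) (sub_nonneg.2 h3), mul_nonneg (sub_nonneg.2 h)
      (mul_nonneg (sub_nonneg.2 h3) (sub_nonneg.2 h3))]
  have h2 : c < (3.411474127810 : ℝ) := by
    by_contra! h
    nlinarith [mul_nonneg (sub_nonneg.2 h) (sub_nonneg.2 h3), mul_nonneg (sub_nonneg.2 h)
      (mul_nonneg (sub_nonneg.2 h3) (sub_nonneg.2 h3))]
  constructor
  · rw [abs_le]; push_cast; constructor <;> linarith
  · rw [abs_le]; push_cast; constructor <;> nlinarith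

theorem moment_nil (A T : Fin 3 → H →L[ℂ] H) (ψ : H) :
    moment A T ψ ([], []) = 12 * ‖ψ‖ ^ 2 := by
  have h1 : (⟪ψ, ψ⟫).re = ‖ψ‖ ^ 2 := by
    rw [inner_self_eq_norm_sq_to_K (𝕜 := ℂ)]; norm_cast
  have h2 : (Fintype.card (Bool × Bool × Fin 3) : ℝ) = 12 := by norm_cast
  simp only [moment, evalWord, evalList, List.map_nil, List.prod_nil, mul_one,
    one_apply_eq_self, h1, Finset.sum_const, Finset.card_univ, nsmul_eq_mul, h2]

theorem FourierRelations.moment_diag {A T : Fin 3 → H →L[ℂ] H} (h : FourierRelations A T) (ψ : H) :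
    moment A T ψ ([(false, 0)], [(false, 0)]) = 4 * (⟪ψ, (∑ k, A k * T k) ψ⟫).re := by
  have h1 (k : Fin 3) : (⟪ψ, (star (A k) * star (T k)) ψ⟫).re = (⟪ψ, (A k * T k) ψ⟫).re := by
    rw [(h.comm k k).star_star.eq, ← star_mul, ContinuousLinearMap.star_eq_adjoint,
      ContinuousLinearMap.adjoint_inner_right]
    exact inner_re_symm (𝕜 := ℂ) _ _
  have h2 (g : Bool × Bool × Fin 3) : (⟪ψ, evalWord (twist g A) (twist g T)
      ([(false, 0)], [(false, 0)]) ψ⟫).re = (⟪ψ, (A g.2.2 * T g.2.2) ψ⟫).re := by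
    obtain ⟨b, r, s⟩ := g
    cases b
    · simp [evalWord, evalList, evalLetter, twist]
    · simpa [evalWord, evalList, evalLetter, twist] using h1 s
  simp only [moment, h2, Fintype.sum_prod_type, Fintype.sum_bool, sum_apply, inner_sum,
    Complex.re_sum]
  ring

open Certificate in
/-- The operator form of the upper bound, read off from the sum-of-squares certificate. -/
theorem FourierRelations.re_inner_sum_le {c : ℝ} (hc : c ^ 3 = 9 * c + 9) (h3 : 3 ≤ c)
    {A T : Fin 3 → H →L[ℂ] H} (h : FourierRelations A T) (ψ : H) :
    (⟪ψ, (∑ k, A k * T k) ψ⟫).re ≤ 3 / 2 * c * ‖ψ‖ ^ 2 := by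
  obtain ⟨hc₁, hc₂⟩ := cubicRoot_bounds hc h3
  have hsymm (M : List (List CubicInt)) (i j : ℕ) : symmEntry M i j = symmEntry M j i := by
    simp only [symmEntry, max_comm, min_comm]
  have heven : 0 ≤ Form.eval c (moment A T ψ) evenForm :=
    h.eval_sosForm_nonneg hc ψ _ _ (hsymm _) _ fun x =>
      sum_val_mul_inner_nonneg (by norm_num) (by norm_num) hc₁ hc₂ (hsymm _) evenGram_psd x
  have hodd : 0 ≤ Form.eval c (moment A T ψ) oddForm :=
    h.eval_sosForm_nonneg hc ψ _ _ (hsymm _) _ fun x =>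
      sum_val_mul_inner_nonneg (by norm_num) (by norm_num) hc₁ hc₂ (hsymm _) oddGram_psd x
  have hrel : Form.eval c (moment A T ψ) (relations.flatMap ConvRelation.form) = 0 := by
    rw [Form.eval_flatMap]
    refine List.sum_eq_zero fun x hx => ?_
    obtain ⟨r, -, rfl⟩ := List.mem_map.1 hx
    exact h.eval_convRelation hc ψ r
  have hid := Form.eval_eq_zero (c := c) (h.moment_canon ψ) sosIdentity_isZero
  have hdiag := h.moment_diag ψ
  generalize (⟪ψ, (∑ k, A k * T k) ψ⟫).re = X at hdiag ⊢
  rw [sosIdentity, Form.eval_append, Form.eval_append, Form.eval_append, hrel] at hid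
  have hlast : Form.eval c (moment A T ψ) [(([], []), ⟨0, -18895680, 0⟩),
      (([x0], [x0]), ⟨37791360, 0, 0⟩)] =
      (-18895680 * c) * (12 * ‖ψ‖ ^ 2) + 37791360 * (4 * X) := by
    simp [Form.eval, CubicInt.val, moment_nil, hdiag]
  rw [hlast] at hid
  linarith

end

/-! ### Unitaries attached to projection-valued measurements -/

section

variable {H : Type*} [NormedAddCommGroup H] [InnerProductSpace ℂ H] [CompleteSpace H]

/-- The operator `∑ i, z ^ i P_i`. -/
noncomputable def phaseOp (z : ℂ) (P : ZMod 3 → H →L[ℂ] H) : H →L[ℂ] H :=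
  P 0 + z • P 1 + z ^ 2 • P 2

theorem ZMod.sum_univ_three {M : Type*} [AddCommMonoid M] (f : ZMod 3 → M) :
    ∑ i, f i = f 0 + f 1 + f 2 := Fin.sum_univ_three f

theorem IsPVM.phaseOp_mul {P : ZMod 3 → H →L[ℂ] H} (hP : IsPVM P) (z z' : ℂ) :
    phaseOp z P * phaseOp z' P = phaseOp (z * z') P := by
  have h := hP.mul_eq
  simp only [phaseOp, mul_add, add_mul, smul_mul_assoc, mul_smul_comm, h]
  simp only [if_true, if_neg (show ¬ (0 : ZMod 3) = 1 by decide),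
    if_neg (show ¬ (0 : ZMod 3) = 2 by decide), if_neg (show ¬ (1 : ZMod 3) = 0 by decide),
    if_neg (show ¬ (1 : ZMod 3) = 2 by decide), if_neg (show ¬ (2 : ZMod 3) = 0 by decide),
    if_neg (show ¬ (2 : ZMod 3) = 1 by decide)]
  module

theorem IsPVM.star_phaseOp {P : ZMod 3 → H →L[ℂ] H} (hP : IsPVM P) (z : ℂ) :
    star (phaseOp z P) = phaseOp (star z) P := by
  have h (i : ZMod 3) : star (P i) = P i := hP.adjoint_eq i
  simp [phaseOp, h]

theorem IsPVM.phaseOp_one {P : ZMod 3 → H →L[ℂ] H} (hP : IsPVM P) : phaseOp 1 P = 1 := by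
  rw [← hP.sum_eq_one, ZMod.sum_univ_three]
  simp [phaseOp]

/-- The primitive third root of unity `exp (2 π i / 3)`. -/
noncomputable def omega : ℂ := ⟨-1 / 2, Real.sqrt 3 / 2⟩

theorem omega_sq_add : omega ^ 2 + omega + 1 = 0 := by
  have h := Real.sq_sqrt (show (0 : ℝ) ≤ 3 by norm_num)
  apply Complex.ext <;> simp [omega, pow_two] <;> nlinarith

theorem star_omega : star omega = omega ^ 2 := by
  have h := Real.sq_sqrt (show (0 : ℝ) ≤ 3 by norm_num)
  apply Complex.ext <;> simp [omega, pow_two] <;> nlinarith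

/-- The Fourier transform `n ↦ ∑ l, ω ^ (-n l) W_l` of a family of operators. -/
noncomputable def fourierOp (W : Fin 3 → H →L[ℂ] H) (n : Fin 3) : H →L[ℂ] H :=
  W 0 + (omega ^ 2) ^ n.val • W 1 + omega ^ n.val • W 2

theorem fourierOp_zero (W : Fin 3 → H →L[ℂ] H) : fourierOp W 0 = W 0 + W 1 + W 2 := by
  simp [fourierOp]

theorem fourierOp_one (W : Fin 3 → H →L[ℂ] H) :
    fourierOp W 1 = W 0 + omega ^ 2 • W 1 + omega • W 2 := by
  simp [fourierOp]

theorem fourierOp_two (W : Fin 3 → H →L[ℂ] H) :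
    fourierOp W 2 = W 0 + omega • W 1 + omega ^ 2 • W 2 := by
  have h : (omega ^ 2) ^ 2 = omega := by
    linear_combination (omega ^ 2 - omega) * omega_sq_add
  simp [fourierOp, h]

/-- By Fourier inversion, the convolution square of `n ↦ T n` is three times the transform of `l ↦ W l ^ 2`,
and `W l ^ 2` is the adjoint of `W l`. -/
theorem fourierOp_conv {W : Fin 3 → H →L[ℂ] H} (hW : ∀ l, W l * W l = star (W l)) (n : Fin 3) :
    ∑ a, fourierOp W a * fourierOp W (n - a) = (3 : ℂ) • star (fourierOp W (-n)) := by
  have hω := omega_sq_add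
  obtain rfl | rfl | rfl : n = 0 ∨ n = 1 ∨ n = 2 := by revert n; decide
  · rw [Fin.sum_univ_three, show (0 - 0 : Fin 3) = 0 by decide, show (0 - 1 : Fin 3) = 2 by decide,
      show (0 - 2 : Fin 3) = 1 by decide, show (-0 : Fin 3) = 0 by decide]
    simp only [fourierOp_zero, fourierOp_one, fourierOp_two, mul_add, add_mul, smul_mul_assoc,
      mul_smul_comm, hW, star_add]
    generalize omega = z at *
    match_scalars <;> grind
  · rw [Fin.sum_univ_three, show (1 - 0 : Fin 3) = 1 by decide, show (1 - 1 : Fin 3) = 0 by decide,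
      show (1 - 2 : Fin 3) = 2 by decide, show (-1 : Fin 3) = 2 by decide]
    simp only [fourierOp_zero, fourierOp_one, fourierOp_two, mul_add, add_mul, smul_mul_assoc,
      mul_smul_comm, hW, star_add, star_smul, star_pow, star_omega]
    generalize omega = z at *
    match_scalars <;> grind
  · rw [Fin.sum_univ_three, show (2 - 0 : Fin 3) = 2 by decide, show (2 - 1 : Fin 3) = 1 by decide,
      show (2 - 2 : Fin 3) = 0 by decide, show (-2 : Fin 3) = 1 by decide]
    simp only [fourierOp_zero, fourierOp_one, fourierOp_two, mul_add, add_mul, smul_mul_assoc,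
      mul_smul_comm, hW, star_add, star_smul, star_pow, star_omega]
    generalize omega = z at *
    match_scalars <;> grind

theorem fourierOp_adj_conv {W : Fin 3 → H →L[ℂ] H} (hW : ∀ l, star (W l) * W l = 1) (n : Fin 3) :
    ∑ a, star (fourierOp W a) * fourierOp W (a + n) = if n = 0 then (9 : ℂ) • 1 else 0 := by
  have hω := omega_sq_add
  obtain rfl | rfl | rfl : n = 0 ∨ n = 1 ∨ n = 2 := by revert n; decide
  · rw [Fin.sum_univ_three, add_zero, add_zero, add_zero, if_pos rfl]
    simp only [fourierOp_zero, fourierOp_one, fourierOp_two, mul_add, add_mul, smul_mul_assoc,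
      mul_smul_comm, hW, star_add, star_smul, star_pow, star_omega]
    generalize omega = z at *
    match_scalars <;> grind
  · rw [Fin.sum_univ_three, show (0 + 1 : Fin 3) = 1 by decide, show (1 + 1 : Fin 3) = 2 by decide,
      show (2 + 1 : Fin 3) = 0 by decide, if_neg (by decide)]
    simp only [fourierOp_zero, fourierOp_one, fourierOp_two, mul_add, add_mul, smul_mul_assoc,
      mul_smul_comm, hW, star_add, star_smul, star_pow, star_omega]
    generalize omega = z at *
    match_scalars <;> grind
  · rw [Fin.sum_univ_three, show (0 + 2 : Fin 3) = 2 by decide, show (1 + 2 : Fin 3) = 0 by decide,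
      show (2 + 2 : Fin 3) = 1 by decide, if_neg (by decide)]
    simp only [fourierOp_zero, fourierOp_one, fourierOp_two, mul_add, add_mul, smul_mul_assoc,
      mul_smul_comm, hW, star_add, star_smul, star_pow, star_omega]
    generalize omega = z at *
    match_scalars <;> grind

theorem fourierOp_conv_adj {W : Fin 3 → H →L[ℂ] H} (hW : ∀ l, W l * star (W l) = 1) (n : Fin 3) :
    ∑ a, fourierOp W a * star (fourierOp W (a + n)) = if n = 0 then (9 : ℂ) • 1 else 0 := by
  have hω := omega_sq_add
  obtain rfl | rfl | rfl : n = 0 ∨ n = 1 ∨ n = 2 := by revert n; decide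
  · rw [Fin.sum_univ_three, add_zero, add_zero, add_zero, if_pos rfl]
    simp only [fourierOp_zero, fourierOp_one, fourierOp_two, mul_add, add_mul, smul_mul_assoc,
      mul_smul_comm, hW, star_add, star_smul, star_pow, star_omega]
    generalize omega = z at *
    match_scalars <;> grind
  · rw [Fin.sum_univ_three, show (0 + 1 : Fin 3) = 1 by decide, show (1 + 1 : Fin 3) = 2 by decide,
      show (2 + 1 : Fin 3) = 0 by decide, if_neg (by decide)]
    simp only [fourierOp_zero, fourierOp_one, fourierOp_two, mul_add, add_mul, smul_mul_assoc,
      mul_smul_comm, hW, star_add, star_smul, star_pow, star_omega]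
    generalize omega = z at *
    match_scalars <;> grind
  · rw [Fin.sum_univ_three, show (0 + 2 : Fin 3) = 2 by decide, show (1 + 2 : Fin 3) = 0 by decide,
      show (2 + 2 : Fin 3) = 1 by decide, if_neg (by decide)]
    simp only [fourierOp_zero, fourierOp_one, fourierOp_two, mul_add, add_mul, smul_mul_assoc,
      mul_smul_comm, hW, star_add, star_smul, star_pow, star_omega]
    generalize omega = z at *
    match_scalars <;> grind

theorem fourierRelations_of_unitary {U W : Fin 3 → H →L[ℂ] H}
    (hU : ∀ k, star (U k) * U k = 1 ∧ U k * star (U k) = 1 ∧ U k * U k = star (U k))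
    (hW : ∀ l, star (W l) * W l = 1 ∧ W l * star (W l) = 1 ∧ W l * W l = star (W l))
    (hc : ∀ k l, Commute (U k) (W l)) (hc' : ∀ k l, Commute (U k) (star (W l))) :
    FourierRelations U (fourierOp W) where
  adj_mul_self k := (hU k).1
  self_mul_adj k := (hU k).2.1
  mul_self k := (hU k).2.2
  comm k n := Commute.add_right (Commute.add_right (hc _ _) ((hc _ _).smul_right _))
    ((hc _ _).smul_right _)
  comm_star k n := by
    simp only [fourierOp, star_add, star_smul]
    exact Commute.add_right (Commute.add_right (hc' _ _) ((hc' _ _).smul_right _))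
      ((hc' _ _).smul_right _)
  conv := fourierOp_conv fun l => (hW l).2.2
  adj_conv := fourierOp_adj_conv fun l => (hW l).1
  conv_adj := fourierOp_conv_adj fun l => (hW l).2.1

theorem commute_phaseOp {P Q : ZMod 3 → H →L[ℂ] H} (h : ∀ i j, Commute (P i) (Q j)) (z z' : ℂ) :
    Commute (phaseOp z P) (phaseOp z' Q) := by
  unfold phaseOp
  refine Commute.add_left (Commute.add_left ?_ (Commute.smul_left ?_ _))
    (Commute.smul_left ?_ _) <;>
  exact Commute.add_right (Commute.add_right (h _ _) ((h _ _).smul_right _))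
    ((h _ _).smul_right _)

theorem IsPVM.phaseOp_omega {P : ZMod 3 → H →L[ℂ] H} (hP : IsPVM P) :
    star (phaseOp omega P) * phaseOp omega P = 1 ∧ phaseOp omega P * star (phaseOp omega P) = 1 ∧
      phaseOp omega P * phaseOp omega P = star (phaseOp omega P) := by
  have hω3 : omega * omega ^ 2 = 1 := by linear_combination (omega - 1) * omega_sq_add
  have hω3' : omega ^ 2 * omega = 1 := by linear_combination (omega - 1) * omega_sq_add
  rw [hP.star_phaseOp, hP.phaseOp_mul, hP.phaseOp_mul, hP.phaseOp_mul, star_omega, hω3, hω3',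
    hP.phaseOp_one, pow_two]
  exact ⟨rfl, rfl, rfl⟩

theorem fourierRelations_of_isPVM {A B : ZMod 3 → ZMod 3 → H →L[ℂ] H} (hA : ∀ k, IsPVM (A k))
    (hB : ∀ l, IsPVM (B l)) (hAB : ∀ k i l j, Commute (A k i) (B l j)) :
    FourierRelations (fun k => phaseOp omega (A k))
      (fourierOp fun l => phaseOp omega (B l)) := by
  refine fourierRelations_of_unitary (fun k => (hA k).phaseOp_omega) (fun l => (hB l).phaseOp_omega)
    (fun k l => commute_phaseOp (fun i j => hAB k i l j) _ _) fun k l => ?_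
  have h := commute_phaseOp (fun i j => hAB k i l j) omega (star omega)
  rwa [← (hB l).star_phaseOp] at h

/-! ### The Bell operator -/

/-- Expansion of the indicator of `i + j = m` in characters of `ℤ/3ℤ`. -/
theorem IsPVM.sum_ite_smul {P Q : ZMod 3 → H →L[ℂ] H} (hP : IsPVM P) (hQ : IsPVM Q) (m : ZMod 3) :
    ∑ i, ∑ j, (if i + j - m = 0 then (1 / 9 : ℂ) else 0) • (P i * Q j) =
      (1 / 27 : ℂ) • (1 + (omega ^ 2) ^ m.val • (phaseOp omega P * phaseOp omega Q) +
        omega ^ m.val • (phaseOp (omega ^ 2) P * phaseOp (omega ^ 2) Q)) := by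
  have hω := omega_sq_add
  have h1 : (1 : H →L[ℂ] H) = (∑ i, P i) * ∑ j, Q j := by
    rw [hP.sum_eq_one, hQ.sum_eq_one, one_mul]
  rw [h1]
  simp only [ZMod.sum_univ_three, phaseOp]
  clear h1 hP hQ
  generalize P 0 = p0
  generalize P 1 = p1
  generalize P 2 = p2
  generalize Q 0 = q0
  generalize Q 1 = q1
  generalize Q 2 = q2
  generalize omega = z at *
  obtain rfl | rfl | rfl : m = 0 ∨ m = 1 ∨ m = 2 := by revert m; decide
  · simp only [show (0 : ZMod 3).val = 0 from rfl,
      show (0 + 0 - 0 : ZMod 3) = 0 by decide, show (0 + 1 - 0 : ZMod 3) ≠ 0 by decide,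
      show (0 + 2 - 0 : ZMod 3) ≠ 0 by decide, show (1 + 0 - 0 : ZMod 3) ≠ 0 by decide,
      show (1 + 1 - 0 : ZMod 3) ≠ 0 by decide, show (1 + 2 - 0 : ZMod 3) = 0 by decide,
      show (2 + 0 - 0 : ZMod 3) ≠ 0 by decide, show (2 + 1 - 0 : ZMod 3) = 0 by decide,
      show (2 + 2 - 0 : ZMod 3) ≠ 0 by decide, if_true, if_false, mul_add, add_mul, smul_mul_assoc,
      mul_smul_comm]
    match_scalars <;> grind
  · simp only [show (1 : ZMod 3).val = 1 from rfl,
      show (0 + 0 - 1 : ZMod 3) ≠ 0 by decide, show (0 + 1 - 1 : ZMod 3) = 0 by decide,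
      show (0 + 2 - 1 : ZMod 3) ≠ 0 by decide, show (1 + 0 - 1 : ZMod 3) = 0 by decide,
      show (1 + 1 - 1 : ZMod 3) ≠ 0 by decide, show (1 + 2 - 1 : ZMod 3) ≠ 0 by decide,
      show (2 + 0 - 1 : ZMod 3) ≠ 0 by decide, show (2 + 1 - 1 : ZMod 3) ≠ 0 by decide,
      show (2 + 2 - 1 : ZMod 3) = 0 by decide, if_true, if_false, mul_add, add_mul, smul_mul_assoc,
      mul_smul_comm]
    match_scalars <;> grind
  · simp only [show (2 : ZMod 3).val = 2 from rfl,
      show (0 + 0 - 2 : ZMod 3) ≠ 0 by decide, show (0 + 1 - 2 : ZMod 3) ≠ 0 by decide,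
      show (0 + 2 - 2 : ZMod 3) = 0 by decide, show (1 + 0 - 2 : ZMod 3) ≠ 0 by decide,
      show (1 + 1 - 2 : ZMod 3) = 0 by decide, show (1 + 2 - 2 : ZMod 3) ≠ 0 by decide,
      show (2 + 0 - 2 : ZMod 3) = 0 by decide, show (2 + 1 - 2 : ZMod 3) ≠ 0 by decide,
      show (2 + 2 - 2 : ZMod 3) ≠ 0 by decide, if_true, if_false, mul_add, add_mul, smul_mul_assoc,
      mul_smul_comm]
    match_scalars <;> grind

/-- The Bell operator in terms of the correlation operators. -/
theorem chshOp_three {A B : ZMod 3 → ZMod 3 → H →L[ℂ] H} (hA : ∀ k, IsPVM (A k))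
    (hB : ∀ l, IsPVM (B l)) :
    chshOp 3 A B = (1 / 27 : ℂ) • ((9 : ℂ) • 1 +
      ∑ k, ∑ l, (omega ^ 2) ^ (k * l).val • (phaseOp omega (A k) * phaseOp omega (B l)) +
      ∑ k, ∑ l, omega ^ (k * l).val • (phaseOp (omega ^ 2) (A k) * phaseOp (omega ^ 2) (B l))) := by
  have h1 : chshOp 3 A B = ∑ k, ∑ l, ∑ i, ∑ j,
      (if i + j - k * l = 0 then (1 / 9 : ℂ) else 0) • (A k i * B l j) := by
    have h2 : (1 : ℂ) / ((3 : ℕ) : ℂ) ^ 2 = 1 / 9 := by norm_num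
    simp only [chshOp, chshCoeff, h2]
    rw [Finset.sum_congr rfl fun i _ => Finset.sum_comm, Finset.sum_comm]
    refine Finset.sum_congr rfl fun k _ => ?_
    rw [Finset.sum_congr rfl fun i _ => Finset.sum_comm, Finset.sum_comm]
  rw [h1]
  simp only [(hA _).sum_ite_smul (hB _), ← Finset.smul_sum, Finset.sum_add_distrib]
  congr 3
  simp only [Finset.sum_const, Finset.card_univ, ZMod.card, smul_smul]
  rw [← Nat.cast_smul_eq_nsmul ℂ]
  norm_num

theorem chshValue_three {A B : ZMod 3 → ZMod 3 → H →L[ℂ] H} (hA : ∀ k, IsPVM (A k))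
    (hB : ∀ l, IsPVM (B l)) (hAB : ∀ k i l j, Commute (A k i) (B l j)) {ψ : H} (hψ : ‖ψ‖ = 1) :
    chshValue 3 A B ψ = 1 / 3 + 2 / 27 * (⟪ψ, (∑ k : Fin 3, phaseOp omega (A k) *
      fourierOp (fun l => phaseOp omega (B l)) k) ψ⟫).re := by
  set X := ∑ k : Fin 3, phaseOp omega (A k) * fourierOp (fun l => phaseOp omega (B l)) k with hX
  have hω := omega_sq_add
  have h1 : ∑ k, ∑ l, (omega ^ 2) ^ (k * l).val • (phaseOp omega (A k) * phaseOp omega (B l))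
      = X := by
    have e (a b : ZMod 3) (c : ℕ) (h : (a * b).val = c) (S : H →L[ℂ] H) :
      (omega ^ 2) ^ (a * b).val • S = (omega ^ 2) ^ c • S := by rw [h]
    rw [hX, Fin.sum_univ_three, ZMod.sum_univ_three, fourierOp_zero, fourierOp_one, fourierOp_two]
    simp only [ZMod.sum_univ_three]
    rw [e 0 0 0 rfl, e 0 1 0 rfl, e 0 2 0 rfl, e 1 0 0 rfl, e 1 1 1 rfl, e 1 2 2 rfl, e 2 0 0 rfl,
      e 2 1 2 rfl, e 2 2 1 rfl]
    have h2 : (omega ^ 2) ^ 2 = omega := by linear_combination (omega ^ 2 - omega) * hω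
    simp only [pow_zero, pow_one, one_smul, h2, mul_add, mul_smul_comm]
    rfl
  have h2 : ∑ k, ∑ l, omega ^ (k * l).val • (phaseOp (omega ^ 2) (A k) * phaseOp (omega ^ 2) (B l))
      = star X := by
    have h3 : omega = (omega ^ 2) ^ 2 := by linear_combination -(omega ^ 2 - omega) * hω
    rw [← h1]
    simp only [star_sum, star_smul, star_mul, star_pow, star_omega, (hA _).star_phaseOp,
      (hB _).star_phaseOp, ← h3]
    refine Finset.sum_congr rfl fun k _ => Finset.sum_congr rfl fun l _ => ?_
    congr 1
    exact (commute_phaseOp (fun i j => hAB k i l j) _ _).eq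
  have h3 : (⟪ψ, (star X) ψ⟫).re = (⟪ψ, X ψ⟫).re := by
    rw [ContinuousLinearMap.star_eq_adjoint, ContinuousLinearMap.adjoint_inner_right]
    exact inner_re_symm (𝕜 := ℂ) _ _
  have h4 : (⟪ψ, ψ⟫).re = 1 := by
    rw [inner_self_eq_norm_sq_to_K (𝕜 := ℂ), hψ]; norm_num
  have h5 : (⟪ψ, ((1 / 27 : ℂ) • ((9 : ℂ) • (1 : H →L[ℂ] H) + X + star X)) ψ⟫).re =
      (1 / 27) * (9 * (⟪ψ, ψ⟫).re + (⟪ψ, X ψ⟫).re + (⟪ψ, (star X) ψ⟫).re) := by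
    rw [show (1 / 27 : ℂ) = ((1 / 27 : ℝ) : ℂ) by norm_num, show (9 : ℂ) = ((9 : ℝ) : ℂ) by norm_num]
    simp only [smul_apply, add_apply, one_apply_eq_self, inner_add_right, inner_smul_right,
      Complex.re_ofReal_mul, Complex.add_re]
  rw [chshValue, chshOp_three hA hB, h1, h2, h5, h3, h4]
  ring

end

/-! ### Tensor-product strategies are commuting-operator strategies -/

section

variable {E : Type v} {F : Type w} [NormedAddCommGroup E] [InnerProductSpace ℂ E]
  [NormedAddCommGroup F] [InnerProductSpace ℂ F]

theorem hilbertTensorOp_coe (S : E →L[ℂ] E) (T : F →L[ℂ] F) (x : E ⊗[ℂ] F) :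
    hilbertTensorOp S T (x : HilbertTensor E F) = (TensorProduct.mapL S T x : E ⊗[ℂ] F) :=
  ContinuousLinearMap.completion_apply_coe _ _

theorem HilbertTensor.clm_ext {f g : HilbertTensor E F →L[ℂ] HilbertTensor E F}
    (h : ∀ x : E ⊗[ℂ] F, f (x : HilbertTensor E F) = g (x : HilbertTensor E F)) : f = g :=
  ContinuousLinearMap.ext fun x => UniformSpace.Completion.induction_on x
    (isClosed_eq f.continuous g.continuous) h

theorem hilbertTensorOp_one : hilbertTensorOp (1 : E →L[ℂ] E) (1 : F →L[ℂ] F) = 1 := by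
  refine HilbertTensor.clm_ext fun x => ?_
  rw [hilbertTensorOp_coe]
  congr 1
  exact DFunLike.congr_fun TensorProduct.mapL_id_id x

theorem hilbertTensorOp_mul (S S' : E →L[ℂ] E) (T T' : F →L[ℂ] F) :
    hilbertTensorOp S T * hilbertTensorOp S' T' = hilbertTensorOp (S * S') (T * T') := by
  refine HilbertTensor.clm_ext fun x => ?_
  rw [mul_apply_eq_comp, hilbertTensorOp_coe, hilbertTensorOp_coe, hilbertTensorOp_coe,
    TensorProduct.mapL_mul, mul_apply_eq_comp]

theorem hilbertTensorOp_add_left (S S' : E →L[ℂ] E) (T : F →L[ℂ] F) :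
    hilbertTensorOp (S + S') T = hilbertTensorOp S T + hilbertTensorOp S' T := by
  refine HilbertTensor.clm_ext fun x => ?_
  rw [add_apply, hilbertTensorOp_coe, hilbertTensorOp_coe, hilbertTensorOp_coe,
    TensorProduct.mapL_add_left, add_apply, UniformSpace.Completion.coe_add]

theorem hilbertTensorOp_add_right (S : E →L[ℂ] E) (T T' : F →L[ℂ] F) :
    hilbertTensorOp S (T + T') = hilbertTensorOp S T + hilbertTensorOp S T' := by
  refine HilbertTensor.clm_ext fun x => ?_
  rw [add_apply, hilbertTensorOp_coe, hilbertTensorOp_coe, hilbertTensorOp_coe,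
    TensorProduct.mapL_add_right, add_apply, UniformSpace.Completion.coe_add]

theorem hilbertTensorOp_smul_left (z : ℂ) (S : E →L[ℂ] E) (T : F →L[ℂ] F) :
    hilbertTensorOp (z • S) T = z • hilbertTensorOp S T := by
  refine HilbertTensor.clm_ext fun x => ?_
  rw [smul_apply, hilbertTensorOp_coe, hilbertTensorOp_coe,
    TensorProduct.mapL_smul_left, smul_apply, UniformSpace.Completion.coe_smul]

theorem hilbertTensorOp_smul_right (z : ℂ) (S : E →L[ℂ] E) (T : F →L[ℂ] F) :
    hilbertTensorOp S (z • T) = z • hilbertTensorOp S T := by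
  refine HilbertTensor.clm_ext fun x => ?_
  rw [smul_apply, hilbertTensorOp_coe, hilbertTensorOp_coe,
    TensorProduct.mapL_smul_right, smul_apply, UniformSpace.Completion.coe_smul]

theorem hilbertTensorOp_zero_left (T : F →L[ℂ] F) :
    hilbertTensorOp (0 : E →L[ℂ] E) T = 0 := by
  simpa using hilbertTensorOp_smul_left 0 (0 : E →L[ℂ] E) T

theorem hilbertTensorOp_zero_right (S : E →L[ℂ] E) :
    hilbertTensorOp S (0 : F →L[ℂ] F) = 0 := by
  simpa using hilbertTensorOp_smul_right 0 S (0 : F →L[ℂ] F)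

theorem hilbertTensorOp_adjoint [CompleteSpace E] [CompleteSpace F] (S : E →L[ℂ] E)
    (T : F →L[ℂ] F) :
    ContinuousLinearMap.adjoint (hilbertTensorOp S T) =
      hilbertTensorOp (ContinuousLinearMap.adjoint S) (ContinuousLinearMap.adjoint T) := by
  symm
  rw [ContinuousLinearMap.eq_adjoint_iff]
  intro x y
  induction x, y using UniformSpace.Completion.induction_on₂ with
  | hp => exact isClosed_eq (by fun_prop) (by fun_prop)
  | ih x y =>
    rw [hilbertTensorOp_coe, hilbertTensorOp_coe, UniformSpace.Completion.inner_coe,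
      UniformSpace.Completion.inner_coe]
    induction x using TensorProduct.induction_on with
    | zero => simp
    | add a b ha hb => rw [map_add, inner_add_left, inner_add_left, ha, hb]
    | tmul a b =>
      induction y using TensorProduct.induction_on with
      | zero => simp
      | add a b ha hb => rw [map_add, inner_add_right, inner_add_right, ha, hb]
      | tmul a' b' =>
        simp [ContinuousLinearMap.adjoint_inner_left]

theorem IsPVM.hilbertTensorOp_left [CompleteSpace E] [CompleteSpace F] {P : ZMod 3 → E →L[ℂ] E}
    (hP : IsPVM P) : IsPVM fun i => hilbertTensorOp (P i) (1 : F →L[ℂ] F) where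
  mul_eq i j := by
    rw [hilbertTensorOp_mul, hP.mul_eq, one_mul]
    split_ifs
    · rfl
    · exact hilbertTensorOp_zero_left _
  sum_eq_one := by
    rw [← hilbertTensorOp_one, ← hP.sum_eq_one, ZMod.sum_univ_three, ZMod.sum_univ_three,
      hilbertTensorOp_add_left, hilbertTensorOp_add_left]
  adjoint_eq i := by
    rw [hilbertTensorOp_adjoint, hP.adjoint_eq, ← ContinuousLinearMap.star_eq_adjoint, star_one]

theorem IsPVM.hilbertTensorOp_right [CompleteSpace E] [CompleteSpace F] {P : ZMod 3 → F →L[ℂ] F}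
    (hP : IsPVM P) : IsPVM fun i => hilbertTensorOp (1 : E →L[ℂ] E) (P i) where
  mul_eq i j := by
    rw [hilbertTensorOp_mul, hP.mul_eq, one_mul]
    split_ifs
    · rfl
    · exact hilbertTensorOp_zero_right _
  sum_eq_one := by
    rw [← hilbertTensorOp_one, ← hP.sum_eq_one, ZMod.sum_univ_three, ZMod.sum_univ_three,
      hilbertTensorOp_add_right, hilbertTensorOp_add_right]
  adjoint_eq i := by
    rw [hilbertTensorOp_adjoint, hP.adjoint_eq, ← ContinuousLinearMap.star_eq_adjoint, star_one]

theorem commute_hilbertTensorOp (S : E →L[ℂ] E) (T : F →L[ℂ] F) :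
    Commute (hilbertTensorOp S (1 : F →L[ℂ] F)) (hilbertTensorOp (1 : E →L[ℂ] E) T) := by
  rw [Commute, SemiconjBy, hilbertTensorOp_mul, hilbertTensorOp_mul, one_mul, one_mul, mul_one,
    mul_one]

end

theorem chshTensorValues_subset : chshTensorValues.{v, w} 3 ⊆ chshCommutingValues.{max v w} 3 := by
  rintro β ⟨E, _, _, _, _, F, _, _, _, _, A, B, ψ, hA, hB, hψ, rfl⟩
  exact ⟨HilbertTensor E F, inferInstance, inferInstance, inferInstance, _, _, ψ,
    fun k => (hA k).hilbertTensorOp_left, fun l => (hB l).hilbertTensorOp_right,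
    fun k i l j => commute_hilbertTensorOp _ _, hψ, rfl⟩

/-! ### Projection-valued measurements from unitaries of order three -/

section

variable {H : Type*} [NormedAddCommGroup H] [InnerProductSpace ℂ H] [CompleteSpace H]

/-- The spectral projection of a unitary of order `3` for the eigenvalue `ω ^ i`. -/
noncomputable def spectralProj (U : H →L[ℂ] H) (i : ZMod 3) : H →L[ℂ] H :=
  (1 / 3 : ℂ) • (1 + (omega ^ i.val) ^ 2 • U + omega ^ i.val • star U)

theorem spectralProj_isPVM {U : H →L[ℂ] H}
    (hU : star U * U = 1 ∧ U * star U = 1 ∧ U * U = star U) : IsPVM (spectralProj U) := by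
  obtain ⟨h1, h2, h3⟩ := hU
  have h4 : star U * star U = U := by simpa using congrArg star h3
  have hω := omega_sq_add
  have v0 : (0 : ZMod 3).val = 0 := rfl
  have v1 : (1 : ZMod 3).val = 1 := rfl
  have v2 : (2 : ZMod 3).val = 2 := rfl
  have hcases (i : ZMod 3) : i = 0 ∨ i = 1 ∨ i = 2 := by revert i; decide
  have hmul (a b : ℂ) : (1 + a ^ 2 • U + a • star U) * (1 + b ^ 2 • U + b • star U) =
      (1 + a ^ 2 * b + a * b ^ 2) • (1 : H →L[ℂ] H) + (a ^ 2 + b ^ 2 + a * b) • U +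
        (a + b + a ^ 2 * b ^ 2) • star U := by
    simp only [mul_add, add_mul, smul_mul_assoc, mul_smul_comm, mul_one, one_mul, h1, h2, h3, h4]
    module
  have hcube (i : ZMod 3) : (omega ^ i.val) ^ 3 = 1 := by
    rw [← pow_mul, mul_comm, pow_mul,
      show omega ^ 3 = 1 by linear_combination (omega - 1) * hω, one_pow]
  refine ⟨fun i j => ?_, ?_, fun i => ?_⟩
  · rw [spectralProj, spectralProj, smul_mul_smul_comm, hmul]
    have hi := hcube i
    have hj := hcube j
    split_ifs with hij
    · subst hij
      generalize omega ^ i.val = a at *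
      match_scalars <;> grind
    · have hab : (omega ^ i.val) ^ 2 + (omega ^ j.val) ^ 2 + omega ^ i.val * omega ^ j.val = 0 := by
        rcases hcases i with rfl | rfl | rfl <;> rcases hcases j with rfl | rfl | rfl
        all_goals first
          | exact absurd rfl hij
          | (simp only [v0, v1, v2]; clear hi hj hij hcube hmul hcases h1 h2 h3 h4; grind)
      generalize omega ^ i.val = a at *
      generalize omega ^ j.val = b at *
      have e1 : 1 + a ^ 2 * b + a * b ^ 2 = 0 := by linear_combination a * hab - hi
      have e2 : a + b + a ^ 2 * b ^ 2 = 0 := by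
        linear_combination a ^ 2 * hab - (a + b) * hi
      rw [hab, e1, e2]
      simp
  · rw [ZMod.sum_univ_three]
    simp only [spectralProj, v0, v1, v2]
    generalize omega = z at *
    match_scalars <;> grind
  · have h5 : star (1 / 3 : ℂ) = 1 / 3 := by
      rw [show (1 / 3 : ℂ) = ((1 / 3 : ℝ) : ℂ) by norm_num]; exact Complex.conj_ofReal _
    have hi := hcube i
    rw [← ContinuousLinearMap.star_eq_adjoint]
    have h6 : star (omega ^ i.val) = (omega ^ i.val) ^ 2 := by
      rw [star_pow, star_omega, ← pow_mul, ← pow_mul, mul_comm]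
    have h7 : ((omega ^ i.val) ^ 2) ^ 2 = omega ^ i.val := by linear_combination omega ^ i.val * hi
    simp only [spectralProj, star_smul, star_add, star_one, star_star, h5, star_pow _ 2, h6, h7]
    rw [add_right_comm]

theorem phaseOp_spectralProj (U : H →L[ℂ] H) : phaseOp omega (spectralProj U) = U := by
  have hω := omega_sq_add
  have v0 : (0 : ZMod 3).val = 0 := rfl
  have v1 : (1 : ZMod 3).val = 1 := rfl
  have v2 : (2 : ZMod 3).val = 2 := rfl
  simp only [phaseOp, spectralProj, v0, v1, v2]
  generalize omega = z at *
  match_scalars <;> grind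

end

/-! ### The optimal strategy -/

/-- The matrix of the cyclic shift `e_j ↦ e_{j+1}` of `ℂ³` with weights `d`. -/
def shiftMatrix (d : Fin 3 → ℂ) : Matrix (Fin 3) (Fin 3) ℂ :=
  Matrix.of fun i j => if i = j + 1 then d j else 0

/-- The weighted cyclic shift as an operator on a Euclidean space (in any universe). -/
noncomputable def shiftOp (d : Fin 3 → ℂ) :
    EuclideanSpace ℂ (ULift.{v} (Fin 3)) →L[ℂ] EuclideanSpace ℂ (ULift.{v} (Fin 3)) :=
  Matrix.toEuclideanCLM (𝕜 := ℂ) ((shiftMatrix d).submatrix Equiv.ulift Equiv.ulift)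

theorem shiftMatrix_add (d e : Fin 3 → ℂ) : shiftMatrix (d + e) = shiftMatrix d + shiftMatrix e := by
  ext i j; simp only [shiftMatrix, Matrix.of_apply, Matrix.add_apply, Pi.add_apply]; split_ifs <;> simp

theorem shiftMatrix_smul (z : ℂ) (d : Fin 3 → ℂ) : shiftMatrix (z • d) = z • shiftMatrix d := by
  ext i j; simp only [shiftMatrix, Matrix.of_apply, Matrix.smul_apply, Pi.smul_apply]; split_ifs <;> simp

theorem shiftOp_add (d e : Fin 3 → ℂ) : shiftOp.{v} (d + e) = shiftOp d + shiftOp e := by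
  rw [shiftOp, shiftMatrix_add]
  exact map_add (Matrix.toEuclideanCLM (𝕜 := ℂ)) _ _

theorem shiftOp_smul (z : ℂ) (d : Fin 3 → ℂ) : shiftOp.{v} (z • d) = z • shiftOp d := by
  rw [shiftOp, shiftMatrix_smul]
  exact (Matrix.toEuclideanCLM (𝕜 := ℂ) (n := ULift.{v} (Fin 3))).map_smul' _ _

theorem shiftOp_unitary {d : Fin 3 → ℂ} (hd : ∀ j, star (d j) * d j = 1)
    (hprod : d 0 * d 1 * d 2 = 1) :
    star (shiftOp.{v} d) * shiftOp d = 1 ∧ shiftOp.{v} d * star (shiftOp d) = 1 ∧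
      shiftOp.{v} d * shiftOp d = star (shiftOp d) := by
  have h0 := hd 0
  have h1 := hd 1
  have h2 := hd 2
  have hM : (shiftMatrix d).conjTranspose * shiftMatrix d = 1 ∧
      shiftMatrix d * (shiftMatrix d).conjTranspose = 1 ∧
      shiftMatrix d * shiftMatrix d = (shiftMatrix d).conjTranspose := by
    refine ⟨?_, ?_, ?_⟩
    all_goals
      ext i j
      fin_cases i <;> fin_cases j <;>
      simp [Matrix.mul_apply, Fin.sum_univ_three, shiftMatrix, Matrix.conjTranspose_apply] at h0 h1 h2 ⊢ <;> grind
  obtain ⟨m1, m2, m3⟩ := hM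
  simp only [shiftOp, ← map_star, Matrix.star_eq_conjTranspose, Matrix.conjTranspose_submatrix,
    ← map_mul, Matrix.submatrix_mul_equiv, m1, m2, m3, Matrix.submatrix_one_equiv, map_one,
    and_self]

/-- The maximally entangled unit vector. -/
noncomputable def entangled : HilbertTensor (EuclideanSpace ℂ (ULift.{v} (Fin 3)))
    (EuclideanSpace ℂ (ULift.{w} (Fin 3))) :=
  (((Real.sqrt 3)⁻¹ : ℝ) : ℂ) • ∑ j : Fin 3, ((EuclideanSpace.single (ULift.up j) (1 : ℂ) ⊗ₜ[ℂ]
    EuclideanSpace.single (ULift.up j) (1 : ℂ) : _ ⊗[ℂ] _) : HilbertTensor _ _)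

theorem shiftOp_inner_single (d : Fin 3 → ℂ) (i j : Fin 3) :
    ⟪EuclideanSpace.single (ULift.up.{v} i) (1 : ℂ),
      shiftOp d (EuclideanSpace.single (ULift.up j) (1 : ℂ))⟫ = if i = j + 1 then d j else 0 := by
  rw [EuclideanSpace.inner_single_left, EuclideanSpace.single, shiftOp, Matrix.toEuclideanCLM_toLp]
  simp [shiftMatrix]

theorem inner_entangled_mapL (S : EuclideanSpace ℂ (ULift.{v} (Fin 3)) →L[ℂ] _)
    (T : EuclideanSpace ℂ (ULift.{w} (Fin 3)) →L[ℂ] _) :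
    ⟪entangled.{v, w}, hilbertTensorOp S T entangled⟫ = (1 / 3) * ∑ j : Fin 3, ∑ i : Fin 3,
      ⟪EuclideanSpace.single (ULift.up i) (1 : ℂ), S (EuclideanSpace.single (ULift.up j) 1)⟫ *
      ⟪EuclideanSpace.single (ULift.up i) (1 : ℂ), T (EuclideanSpace.single (ULift.up j) 1)⟫ := by
  have h : ((Real.sqrt 3)⁻¹ : ℝ) * (Real.sqrt 3)⁻¹ = 1 / 3 := by
    rw [← mul_inv, Real.mul_self_sqrt (by norm_num)]; norm_num
  rw [entangled, map_smul, map_sum, inner_smul_left, inner_smul_right, Complex.conj_ofReal,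
    ← mul_assoc, ← Complex.ofReal_mul, h, inner_sum]
  simp only [sum_inner, hilbertTensorOp_coe, UniformSpace.Completion.inner_coe,
    TensorProduct.mapL_tmul, TensorProduct.inner_tmul]
  norm_num

theorem inner_entangled_shiftOp (d e : Fin 3 → ℂ) :
    ⟪entangled.{v, w}, hilbertTensorOp (shiftOp d) (shiftOp e) entangled⟫ =
      (1 / 3) * ∑ j, d j * e j := by
  rw [inner_entangled_mapL]
  simp only [shiftOp_inner_single]
  congr 1
  refine Finset.sum_congr rfl fun j _ => ?_
  simp

theorem norm_entangled : ‖entangled.{v, w}‖ = 1 := by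
  have h := inner_entangled_mapL.{v, w} 1 1
  have h1 : ∑ j : Fin 3, ∑ i : Fin 3,
      ⟪EuclideanSpace.single (ULift.up.{v} i) (1 : ℂ), EuclideanSpace.single (ULift.up j) (1 : ℂ)⟫ *
      ⟪EuclideanSpace.single (ULift.up.{w} i) (1 : ℂ), EuclideanSpace.single (ULift.up j) (1 : ℂ)⟫ =
      3 := by
    simp [EuclideanSpace.inner_single_left]
  rw [hilbertTensorOp_one] at h
  simp only [one_apply_eq_self] at h
  rw [h1, inner_self_eq_norm_sq_to_K] at h
  have h2 : ‖entangled.{v, w}‖ ^ 2 = 1 := by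
    have : ((‖entangled.{v, w}‖ ^ 2 : ℝ) : ℂ) = ((1 : ℝ) : ℂ) := by
      push_cast; rw [← Complex.coe_algebraMap] ; simpa using h
    exact_mod_cast this
  exact (pow_eq_one_iff_of_nonneg (norm_nonneg _) two_ne_zero).1 h2

/-- The primitive ninth root of unity `exp (2 π i / 9)`, a cube root of `omega`. -/
noncomputable def zeta : ℂ := Complex.exp ((2 * Real.pi / 9 : ℝ) * Complex.I)

theorem star_zeta_mul : star zeta * zeta = 1 := by
  have h : ‖zeta‖ = 1 := Complex.norm_exp_ofReal_mul_I _
  have h2 := Complex.conj_mul' zeta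
  rw [h] at h2
  simpa using h2

theorem zeta_pow_three : zeta ^ 3 = omega := by
  have h1 : zeta ^ 3 = Complex.exp ((2 * Real.pi / 3 : ℝ) * Complex.I) := by
    rw [zeta, ← Complex.exp_nat_mul]
    congr 1
    push_cast
    ring
  have h2 : 2 * Real.pi / 3 = Real.pi - Real.pi / 3 := by ring
  rw [h1, h2]
  apply Complex.ext
  · rw [Complex.exp_ofReal_mul_I_re, Real.cos_pi_sub, Real.cos_pi_div_three]
    simp only [omega]; norm_num
  · rw [Complex.exp_ofReal_mul_I_im, Real.sin_pi_sub, Real.sin_pi_div_three]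
    rfl

theorem re_two_add_omega_sq_mul_zeta :
    ((2 + omega ^ 2) * zeta).re = Real.sqrt 3 * Real.cos (Real.pi / 18) := by
  have h3 := Real.sq_sqrt (show (0 : ℝ) ≤ 3 by norm_num)
  have h1 : Real.pi / 18 = 2 * Real.pi / 9 - Real.pi / 6 := by ring
  rw [h1, Real.cos_sub, Real.cos_pi_div_six, Real.sin_pi_div_six, ← star_omega, zeta,
    Complex.mul_re, Complex.exp_ofReal_mul_I_re, Complex.exp_ofReal_mul_I_im]
  simp [omega]
  linear_combination (-1 / 2) * Real.cos (2 * Real.pi / 9) * h3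

theorem phaseOp_hilbertTensorOp_left {E : Type v} {F : Type w} [NormedAddCommGroup E]
    [InnerProductSpace ℂ E] [NormedAddCommGroup F] [InnerProductSpace ℂ F] (z : ℂ)
    (P : ZMod 3 → E →L[ℂ] E) :
    phaseOp z (fun i => hilbertTensorOp (P i) (1 : F →L[ℂ] F)) =
      hilbertTensorOp (phaseOp z P) 1 := by
  simp only [phaseOp, hilbertTensorOp_add_left, hilbertTensorOp_smul_left]

theorem phaseOp_hilbertTensorOp_right {E : Type v} {F : Type w} [NormedAddCommGroup E]
    [InnerProductSpace ℂ E] [NormedAddCommGroup F] [InnerProductSpace ℂ F] (z : ℂ)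
    (P : ZMod 3 → F →L[ℂ] F) :
    phaseOp z (fun i => hilbertTensorOp (1 : E →L[ℂ] E) (P i)) =
      hilbertTensorOp 1 (phaseOp z P) := by
  simp only [phaseOp, hilbertTensorOp_add_right, hilbertTensorOp_smul_right]

/-- The weights of Alice's shifts in the optimal strategy. The factor `omega ^ 2` makes their product
`1`, so that the shift has cube `1`. -/
noncomputable def aliceWeight (k j : Fin 3) : ℂ := if j = k then zeta * omega ^ 2 else zeta

/-- The weights of Bob's shifts in the optimal strategy. -/
noncomputable def bobWeight (l j : Fin 3) : ℂ := omega ^ (l.val ^ 2 + l.val * j.val)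

theorem omega_pow_three : omega ^ 3 = 1 := by linear_combination (omega - 1) * omega_sq_add

theorem star_omega_pow_mul (n : ℕ) : star (omega ^ n) * omega ^ n = 1 := by
  rw [star_pow, star_omega, ← mul_pow, ← pow_succ, omega_pow_three, one_pow]

theorem aliceOp_unitary (k : Fin 3) : star (shiftOp.{v} (aliceWeight k)) * shiftOp (aliceWeight k)
    = 1 ∧ shiftOp.{v} (aliceWeight k) * star (shiftOp (aliceWeight k)) = 1 ∧
      shiftOp.{v} (aliceWeight k) * shiftOp (aliceWeight k) = star (shiftOp (aliceWeight k)) := by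
  refine shiftOp_unitary (fun j => ?_) ?_
  · unfold aliceWeight
    split_ifs
    · rw [star_mul]
      linear_combination (star (omega ^ 2) * omega ^ 2) * star_zeta_mul + star_omega_pow_mul 2
    · exact star_zeta_mul
  · have h1 := zeta_pow_three
    have h2 := omega_pow_three
    fin_cases k <;> simp [aliceWeight] <;> linear_combination omega ^ 2 * h1 + h2

theorem bobOp_unitary (l : Fin 3) : star (shiftOp.{v} (bobWeight l)) * shiftOp (bobWeight l)
    = 1 ∧ shiftOp.{v} (bobWeight l) * star (shiftOp (bobWeight l)) = 1 ∧
      shiftOp.{v} (bobWeight l) * shiftOp (bobWeight l) = star (shiftOp (bobWeight l)) := by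
  refine shiftOp_unitary (fun j => star_omega_pow_mul _) ?_
  have h : bobWeight l 0 * bobWeight l 1 * bobWeight l 2 = (omega ^ 3) ^ (l.val ^ 2 + l.val) := by
    simp only [bobWeight, Fin.val_zero, Fin.val_one, Fin.val_two]; ring
  rw [h, omega_pow_three, one_pow]

/-- Bob's transformed weights are `(2 + ω ^ 2) ζ` times the conjugates of Alice's, so that all nine
products of weights agree. -/
theorem sum_aliceWeight_mul (k : Fin 3) :
    ∑ j, aliceWeight k j * (bobWeight 0 + (omega ^ 2) ^ k.val • bobWeight 1 +
      omega ^ k.val • bobWeight 2) j = 3 * ((2 + omega ^ 2) * zeta) := by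
  have h := omega_sq_add
  rw [Fin.sum_univ_three]
  simp only [aliceWeight, Pi.add_apply, Pi.smul_apply, smul_eq_mul, bobWeight, Fin.val_zero, Fin.val_one,
    Fin.val_two]
  generalize omega = z at *
  generalize zeta = y
  fin_cases k <;> simp <;> grind

theorem fourierOp_shiftOp (k : Fin 3) :
    fourierOp (fun l => shiftOp.{v} (bobWeight l)) k =
      shiftOp (bobWeight 0 + (omega ^ 2) ^ k.val • bobWeight 1 + omega ^ k.val • bobWeight 2) := by
  rw [shiftOp_add, shiftOp_add, shiftOp_smul, shiftOp_smul, fourierOp]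

theorem optimum_mem_chshTensorValues :
    1 / 3 + 2 * Real.cos (Real.pi / 18) / (3 * Real.sqrt 3) ∈ chshTensorValues.{v, w} 3 := by
  have hA (k : ZMod 3) : IsPVM (spectralProj (shiftOp.{v} (aliceWeight k))) :=
    spectralProj_isPVM (aliceOp_unitary k)
  have hB (l : ZMod 3) : IsPVM (spectralProj (shiftOp.{w} (bobWeight l))) :=
    spectralProj_isPVM (bobOp_unitary l)
  refine ⟨_, inferInstance, inferInstance, inferInstance, inferInstance, _, inferInstance,
    inferInstance, inferInstance, inferInstance, fun k => spectralProj (shiftOp.{v} (aliceWeight k)),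
    fun l => spectralProj (shiftOp.{w} (bobWeight l)), entangled, hA, hB, norm_entangled, ?_⟩
  rw [chshValue_three (fun k => (hA k).hilbertTensorOp_left)
    (fun l => (hB l).hilbertTensorOp_right) (fun _ _ _ _ => commute_hilbertTensorOp _ _)
    norm_entangled]
  have h1 (k : Fin 3) : phaseOp omega (fun i => hilbertTensorOp (spectralProj
      (shiftOp.{v} (aliceWeight k)) i) (1 : EuclideanSpace ℂ (ULift.{w} (Fin 3)) →L[ℂ] _)) =
      hilbertTensorOp (shiftOp (aliceWeight k)) 1 := by
    rw [phaseOp_hilbertTensorOp_left, phaseOp_spectralProj]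
  have h2 (l : Fin 3) : phaseOp omega (fun j => hilbertTensorOp
      (1 : EuclideanSpace ℂ (ULift.{v} (Fin 3)) →L[ℂ] _)
      (spectralProj (shiftOp.{w} (bobWeight l)) j)) = hilbertTensorOp 1 (shiftOp (bobWeight l)) := by
    rw [phaseOp_hilbertTensorOp_right, phaseOp_spectralProj]
  have h3 (k : Fin 3) : fourierOp (fun l => hilbertTensorOp
      (1 : EuclideanSpace ℂ (ULift.{v} (Fin 3)) →L[ℂ] _) (shiftOp.{w} (bobWeight l))) k =
      hilbertTensorOp 1 (fourierOp (fun l => shiftOp (bobWeight l)) k) := by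
    simp only [fourierOp, hilbertTensorOp_add_right, hilbertTensorOp_smul_right]
  have h4 : ⟪entangled.{v, w}, (∑ k : Fin 3, hilbertTensorOp (shiftOp (aliceWeight k)) 1 *
      hilbertTensorOp 1 (fourierOp (fun l => shiftOp (bobWeight l)) k) :
      HilbertTensor _ _ →L[ℂ] HilbertTensor _ _) entangled⟫ =
      3 * ((2 + omega ^ 2) * zeta) := by
    simp only [hilbertTensorOp_mul, one_mul, mul_one, fourierOp_shiftOp, sum_apply, inner_sum,
      inner_entangled_shiftOp, sum_aliceWeight_mul, Finset.sum_const, Finset.card_univ,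
      Fintype.card_fin, nsmul_eq_mul]
    push_cast; ring
  have h5 := congrArg Complex.re h4
  rw [show (3 : ℂ) = ((3 : ℝ) : ℂ) by norm_num, Complex.re_ofReal_mul,
    re_two_add_omega_sq_mul_zeta] at h5
  have h6 : 2 * Real.cos (Real.pi / 18) / (3 * Real.sqrt 3) =
      2 / 27 * (3 * (Real.sqrt 3 * Real.cos (Real.pi / 18))) := by
    have h3 := Real.sq_sqrt (show (0 : ℝ) ≤ 3 by norm_num)
    have : Real.sqrt 3 ≠ 0 := by positivity
    field_simp
    linear_combination (-9 * Real.cos (Real.pi / 18)) * h3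
  rw [h6, ← h5]
  congr 4
  refine DFunLike.congr_fun (Finset.sum_congr rfl fun k _ => ?_) _
  rw [← h1 k, ← h3 k]
  simp only [← h2]

/-! ### The maximal quantum value -/

theorem cubic_two_sqrt_three_mul_cos : (2 * Real.sqrt 3 * Real.cos (Real.pi / 18)) ^ 3 =
    9 * (2 * Real.sqrt 3 * Real.cos (Real.pi / 18)) + 9 := by
  have h1 := Real.cos_three_mul (Real.pi / 18)
  rw [show 3 * (Real.pi / 18) = Real.pi / 6 by ring, Real.cos_pi_div_six] at h1
  have h2 := Real.sq_sqrt (show (0 : ℝ) ≤ 3 by norm_num)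
  generalize Real.sqrt 3 = s at *
  generalize Real.cos (Real.pi / 18) = x at *
  linear_combination (-2) * s ^ 3 * h1 + (s ^ 2 + 3 + 6 * s * x) * h2

theorem three_le_two_sqrt_three_mul_cos : 3 ≤ 2 * Real.sqrt 3 * Real.cos (Real.pi / 18) := by
  have h1 : Real.cos (Real.pi / 6) ≤ Real.cos (Real.pi / 18) :=
    Real.cos_le_cos_of_nonneg_of_le_pi (by positivity) (by linarith [Real.pi_pos])
      (by linarith [Real.pi_pos])
  rw [Real.cos_pi_div_six] at h1
  have h2 := Real.sq_sqrt (show (0 : ℝ) ≤ 3 by norm_num)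
  nlinarith [Real.sqrt_nonneg 3]

theorem le_of_mem_chshCommutingValues {β : ℝ} (hβ : β ∈ chshCommutingValues.{u} 3) :
    β ≤ 1 / 3 + 2 * Real.cos (Real.pi / 18) / (3 * Real.sqrt 3) := by
  obtain ⟨H, _, _, _, A, B, ψ, hA, hB, hAB, hψ, rfl⟩ := hβ
  rw [chshValue_three hA hB hAB hψ]
  have h := (fourierRelations_of_isPVM hA hB hAB).re_inner_sum_le cubic_two_sqrt_three_mul_cos
    three_le_two_sqrt_three_mul_cos ψ
  rw [hψ] at h
  have h1 : 2 * Real.cos (Real.pi / 18) / (3 * Real.sqrt 3) =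
      2 / 27 * (3 / 2 * (2 * Real.sqrt 3 * Real.cos (Real.pi / 18)) * 1 ^ 2) := by
    have h3 := Real.sq_sqrt (show (0 : ℝ) ≤ 3 by norm_num)
    have : Real.sqrt 3 ≠ 0 := by positivity
    field_simp
    linear_combination (-9 * Real.cos (Real.pi / 18)) * h3
  rw [h1]
  linarith

theorem theorem1 :
    IsGreatest (chshCommutingValues.{u} 3)
        (1 / 3 + 2 * Real.cos (Real.pi / 18) / (3 * Real.sqrt 3)) ∧
      IsGreatest (chshTensorValues.{v, w} 3)
        (1 / 3 + 2 * Real.cos (Real.pi / 18) / (3 * Real.sqrt 3)) :=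
  ⟨⟨chshTensorValues_subset.{u, u} optimum_mem_chshTensorValues,
      fun _ hβ => le_of_mem_chshCommutingValues hβ⟩,
    ⟨optimum_mem_chshTensorValues,
      fun _ hβ => le_of_mem_chshCommutingValues (chshTensorValues_subset hβ)⟩⟩
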